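/- Let $d\ge 1$ and $\varepsilon>0$. Write $\|\cdot\|$ for the norm of $L_2(\mathbb R^d)$ and $\hat f(\xi)=(2\pi)^{-d/2}\int f(x)e^{-ix\cdot\xi}\,dx$ for the (unitary) Fourier transform. A *knot set* with parameter $\lambda>0$ is a countable set $\Xi=\Xi(\lambda)\subset\mathbb R^d$ such that there are pairwise disjoint open sets $Q(\xi_\nu)$, $\xi_\nu\in\Xi$, of diameter at most $\lambda$, such that $Q(\xi_\nu)\cap\Xi=\{\xi_\nu\}$, each closure $\overline{Q(\xi_\nu)}$ is homeomorphic to a closed ball, and the closures cover $\mathbb R^d$. Knot sets are assumed to be uniformly separated: $\inf_{\nu\ne\mu}|\xi_\nu-\xi_\mu|>0$. For an integer $k>d/2$ let $E^k(\xi)=(2\pi)^{-d}\int e^{i\xi\cdot x}(|x|^2+\varepsilon)^{-k}\,dx$. For $\xi_\nu\in\Xi$ let $L^k_\nu=\sum_\mu a_\mu E^k(\cdot-\xi_\mu)$ be the function with $(a_\mu)\in\ell_2$, $L^k_\nu(\xi_\nu)=1$ and $L^k_\nu(\xi_\gamma)=0$ for $\gamma\neq\nu$, and let $\Lambda^k_\nu\in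 L_2(\mathbb R^d)$ be the inverse Fourier transform of $L^k_\nu$. For $\varphi\in C_0^\infty(\mathbb R^d)$ let $R\varphi(\theta,s)=\int_{\theta^\perp}\varphi(s\theta+y)\,dy$ ($\theta\in S^{d-1}$, $s\in\mathbb R$) and $\widehat{(R\varphi)}(\theta,\tau)=(2\pi)^{-1/2}\int R\varphi(\theta,s)e^{-is\tau}\,ds$. Write $\widehat{(R\varphi)}(\xi)=\widehat{(R\varphi)}(\theta,\tau)$ for $\xi=\tau\theta$, $\tau=|\xi|$ (with any direction $\theta$ when $\xi=0$), and let $\|R\varphi\|$ denote the $L_2(\mathbb R^d)$ norm of the function $\xi\mapsto\widehat{(R\varphi)}(\xi)$, that is $\|R\varphi\|^2=\int_{S^{d-1}}\int_0^\infty|\widehat{(R\varphi)}(\theta,\tau)|^2\tau^{d-1}\,d\tau\,d\theta$. **Lemma 3.2.** There is a constant $c=c(d,\varepsilon)>0$, depending only on $d$ and $\varepsilon$, with the following property. Let $\Xi(\lambda)$ be a (uniformly separated) knot set. Then the functions $\Lambda^k_\nu$ exist and are unique for every $\nu$ and every integer $k>d/2$. If moreover $\sigma>0$, $\lambda<(c(\sigma+\varepsilon))^{-1}$,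 $r\ge[d/2]+1$ is an integer and $\varphi\in C_0^\infty(\mathbb R^d)$ is supported in the closed ball of radius $\sigma$ centred at $0$, then $$\varphi=\lim_{l\to\infty}(2\pi)^{(1-d)/2}\sum_{\xi_\nu\in\Xi(\lambda)}\widehat{(R\varphi)}(\xi_\nu)\,\Lambda_\nu^{2^lr},$$ where for each $l$ the sum converges unconditionally in $L_2(\mathbb R^d)$ and the limit is in $L_2(\mathbb R^d)$, and for every $l=0,1,2,\dots$ $$\Bigl\|\varphi-(2\pi)^{(1-d)/2}\sum_{\nu}\widehat{(R\varphi)}(\xi_\nu)\Lambda_\nu^{2^lr}\Bigr\|\le 2\,(c\lambda(\sigma+\varepsilon))^{2^{l+1}r}\,\|R\varphi\|.$$ -/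

import Mathlib

open MeasureTheory Filter Topology
open scoped ENNReal FourierTransform ContDiff RealInnerProductSpace

noncomputable section

namespace RadonSampling

/-- Euclidean space of dimension `d`. -/
abbrev Euc (d : ℕ) : Type := EuclideanSpace ℝ (Fin d)

/-- `Ξ` is a knot set with parameter `lam`: a countable set together with a system of pairwise
disjoint open cells `Q ξ`, `ξ ∈ Ξ`, of diameter at most `lam`, such that `ξ` is the only point
of `Ξ` in `Q ξ`, every closed cell is a topological closed ball, and the closed cells cover the
space. -/
structure IsKnotSet {d : ℕ} (lam : ℝ) (Ξ : Set (Euc d)) : Prop where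
  countable : Ξ.Countable
  exists_cells : ∃ Q : Euc d → Set (Euc d),
    (∀ ξ ∈ Ξ, IsOpen (Q ξ)) ∧
    (∀ ξ ∈ Ξ, Q ξ ∩ Ξ = {ξ}) ∧
    (∀ ξ ∈ Ξ, Nonempty (closure (Q ξ) ≃ₜ Metric.closedBall (0 : Euc d) 1)) ∧
    (∀ ξ ∈ Ξ, Metric.ediam (Q ξ) ≤ ENNReal.ofReal lam) ∧
    Ξ.PairwiseDisjoint Q ∧
    (⋃ ξ ∈ Ξ, closure (Q ξ)) = Set.univ

/-- Distinct knots stay at a distance bounded below by a positive number. -/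
def UniformlySeparated {d : ℕ} (Ξ : Set (Euc d)) : Prop :=
  ∃ δ : ℝ, 0 < δ ∧ Ξ.Pairwise fun x y => δ ≤ dist x y

/-- The fundamental solution `E^k` of `(Δ + ε)^k` (`Δ` the positive Laplacian), for `2 k > d`:
`E^k(ξ) = (2π)^{-d} ∫ e^{i ξ·x} (|x|² + ε)^{-k} dx`. -/
def fundSol (d : ℕ) (ε : ℝ) (k : ℕ) (ξ : Euc d) : ℂ :=
  (((2 * Real.pi) ^ d)⁻¹ : ℝ) *
    ∫ x : Euc d, Complex.exp (Complex.I * (⟪ξ, x⟫ : ℝ)) * ((((‖x‖ ^ 2 + ε) ^ k)⁻¹ : ℝ) : ℂ)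

/-- `L` is the Lagrange function `L^k_ν` of the knot set `Ξ`: a linear combination
`∑_μ a_μ E^k(· - ξ_μ)` of translates of `E^k` with coefficients in `ℓ²`, which takes the value
`1` at `ν` and `0` at all other knots. -/
def IsLagrange {d : ℕ} (ε : ℝ) (Ξ : Set (Euc d)) (k : ℕ) (ν : Ξ) (L : Euc d → ℂ) : Prop :=
  (∃ a : Ξ → ℂ, Summable (fun μ => ‖a μ‖ ^ 2) ∧
    ∀ ξ : Euc d, HasSum (fun μ : Ξ => a μ * fundSol d ε k (ξ - μ)) (L ξ)) ∧
  L ν = 1 ∧ ∀ γ : Ξ, γ ≠ ν → L γ = 0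

/-- `L` is (almost everywhere) the unitary Fourier transform
`Λ ↦ (2π)^{-d/2} ∫ Λ(x) e^{-i x·ξ} dx` of the `L²` function `Λ`, i.e. `Λ` is the inverse Fourier
transform of `L`. Mathlib's `𝓕` on `L²` has the kernel `e^{-2π i x·ξ}`. -/
def IsFourierOf {d : ℕ} (L : Euc d → ℂ) (Λ : Lp ℂ 2 (volume : Measure (Euc d))) : Prop :=
  ∀ᵐ ξ : Euc d, L ξ =
    (((2 * Real.pi) ^ (-(d : ℝ) / 2) : ℝ) : ℂ) *
      (𝓕 Λ : Lp ℂ 2 (volume : Measure (Euc d))) ((2 * Real.pi)⁻¹ • ξ)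

/-- `Λ` is the function `Λ^k_ν`: the inverse Fourier transform of the Lagrange function
`L^k_ν`. -/
def IsDualLagrange {d : ℕ} (ε : ℝ) (Ξ : Set (Euc d)) (k : ℕ) (ν : Ξ)
    (Λ : Lp ℂ 2 (volume : Measure (Euc d))) : Prop :=
  ∃ L : Euc d → ℂ, IsLagrange ε Ξ k ν L ∧ IsFourierOf L Λ

/-- The Radon transform `Rφ(θ, s) = ∫_{θ^⊥} φ(s θ + y) dy`, with Lebesgue measure on the
hyperplane `θ^⊥`. -/
def radon {d : ℕ} (φ : Euc d → ℂ) (θ : Euc d) (s : ℝ) : ℂ :=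
  ∫ y : (ℝ ∙ θ)ᗮ, φ (s • θ + (y : Euc d)) ∂(measureSpaceOfInnerProductSpace.volume)

/-- The Fourier transform of `Rφ` in the second variable,
`(2π)^{-1/2} ∫ Rφ(θ, s) e^{-i s τ} ds`. -/
def radonFourier {d : ℕ} (φ : Euc d → ℂ) (θ : Euc d) (τ : ℝ) : ℂ :=
  (((2 * Real.pi) ^ (-(1 : ℝ) / 2) : ℝ) : ℂ) *
    ∫ s : ℝ, radon φ θ s * Complex.exp (-(Complex.I * ((s * τ : ℝ) : ℂ)))

/-- The direction `ξ / |ξ|` of `ξ`; at `ξ = 0` any unit vector will do, and the first coordinate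
vector is taken. -/
def direction {d : ℕ} [NeZero d] (ξ : Euc d) : Euc d :=
  open Classical in if ξ = 0 then EuclideanSpace.single 0 1 else ‖ξ‖⁻¹ • ξ

/-- The Fourier transform of `Rφ` in the second variable, as a function of the point `ξ = τ θ`
with polar coordinates `θ ∈ S^{d-1}`, `τ = |ξ|`. -/
def radonFourierAt {d : ℕ} [NeZero d] (φ : Euc d → ℂ) (ξ : Euc d) : ℂ :=
  radonFourier φ (direction ξ) ‖ξ‖

/-- The norm of `Rφ`: the `L²(ℝ^d)` norm of its Fourier transform in the second variable, as a
function of `ξ = τ θ`. In polar coordinates its square is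
`∫_{S^{d-1}} ∫_0^∞ |(Rφ)^(θ, τ)|² τ^{d-1} dτ dθ`. -/
def radonNorm {d : ℕ} [NeZero d] (φ : Euc d → ℂ) : ℝ :=
  (eLpNorm (radonFourierAt φ) 2 volume).toReal

end RadonSampling

end

/-!
Write `w = (‖x‖² + ε) ^ (k / 2)`. By the Fourier slice theorem (`radonFourierAt_eq_fourier`) the
samples of the Radon transform are samples of the Fourier transform of `φ`, that is, up to
normalization, the inner products of `F = w φ` with the weighted exponentials
`v ξ = w⁻¹ e ^ (i ξ·x)`, `ξ ∈ Ξ`, and the theorem is about the approximation of `F` by its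
orthogonal projection onto the closed span of these vectors.

*Expansion.* The kernel `E^k(ξ - ξ')` is a multiple of `⟪v ξ, v ξ'⟫`. For uniformly separated knots
the family `v` is a Bessel family (`isBesselFamily_modulation`), and it has a biorthogonal Bessel
family, built from the translates of a bump function (`exists_biorthogonal_modulation`). Hence it is
a Riesz sequence (`exists_biorthogonal_expansion`): the Lagrange functions exist and are unique, the
functions `w Λ^k_ν` are multiples of the dual family in the closed span of `v`, and the series with
the samples of `φ` as coefficients converges to `φ - ρ`, where `w (φ - ρ)` is the orthogonal
projection `P F` of `F` (`exists_dualLagrange_expansion`).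

*Error.* The Fourier transform of the remainder `ρ` vanishes on the knots, which are `λ`-dense. The
sampling inequality (`exists_sampling_inequality`) therefore bounds `‖ρ‖` by `(C λ) ^ k ‖w ρ‖`, with
`C` independent of `k`. Its proof writes the Fourier transform of `ρ` as a convolution with a kernel
which is square integrable with an exponential weight, a product of one-dimensional Gamma densities
(`exists_besselKernel`); by continuity of translations its oscillation at a small scale is small
compared with the Sobolev norm of some fixed order `m > d / 2`, so that the `L²` part of that norm
can be absorbed (`exists_lintegral_sq_le_of_fourier_eq_zero`). Young's inequality passes from `m` to
`k ≥ m` without a loss in the constant (`lintegral_sq_le_of_le`), and dilation gives the power of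
`λ`. Moreover `‖w ρ‖² = ⟪w ρ, w φ⟫ ≤ ‖ρ‖ ‖w² φ‖` since `w ρ` is orthogonal to `P F`, and therefore
`‖ρ‖ ≤ (C λ) ^ (2 k) ‖w² φ‖ ≤ (C λ) ^ (2 k) (σ² + ε) ^ k ‖φ‖`. With `k = 2 ^ l r` and
`σ² + ε ≤ (1 + ε⁻¹)² (σ + ε)²` this is the claimed bound, and the norm of `φ` is at most that of its Radon transform
(`norm_toLp_le_radonNorm`).
-/

/-! ### The Fourier transform on `L¹ ∩ L²` -/

section FourierL2

variable {V : Type*} [NormedAddCommGroup V] [InnerProductSpace ℝ V] [FiniteDimensional ℝ V]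
  [MeasurableSpace V] [BorelSpace V]

theorem integral_fourier_mul_eq_flip {f g : V → ℂ} (hf : Integrable f) (hg : Integrable g) :
    ∫ ξ, 𝓕 f ξ * g ξ = ∫ x, f x * 𝓕 g x := by
  simpa using! VectorFourier.integral_fourierIntegral_smul_eq_flip (L := innerₗ V)
    Real.continuous_fourierChar continuous_inner hf hg

theorem continuous_fourier_of_integrable {f : V → ℂ} (hf : Integrable f) : Continuous (𝓕 f) :=
  VectorFourier.fourierIntegral_continuous (L := innerₗ V) Real.continuous_fourierChar
    continuous_inner hf

/-- On `L¹ ∩ L²` the `L²` Fourier transform is given by the Fourier integral. -/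
theorem fourier_toLp_ae_eq {u : V → ℂ} (h1 : Integrable u) (h2 : MemLp u 2) :
    (𝓕 (h2.toLp u) : Lp ℂ 2 (volume : Measure V)) =ᵐ[volume] 𝓕 u := by
  refine ae_eq_of_integral_contDiff_smul_eq
    ((Lp.memLp _).locallyIntegrable one_le_two)
    (continuous_fourier_of_integrable h1).locallyIntegrable fun g hg hc => ?_
  have hc' : HasCompactSupport (fun x => (g x : ℂ)) := hc.comp_left (g := fun t : ℝ => (t : ℂ)) rfl
  let G : SchwartzMap V ℂ := hc'.toSchwartzMap (Complex.ofRealCLM.contDiff.comp hg)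
  have hG : ∀ x, G x = (g x : ℂ) := fun x => rfl
  have key := congrArg (fun T => T G) (Lp.fourier_toTemperedDistribution_eq (h2.toLp u))
  simp only [TemperedDistribution.fourier_apply, Lp.toTemperedDistribution_apply, hG,
    smul_eq_mul] at key
  simp only [Complex.real_smul]
  rw [← key]
  have e1 : ∫ x, (𝓕 G) x * (h2.toLp u) x = ∫ x, (𝓕 (G : V → ℂ)) x * u x := by
    refine integral_congr_ae ?_
    filter_upwards [h2.coeFn_toLp] with x hx
    rw [hx, SchwartzMap.fourier_coe]
  rw [e1, integral_fourier_mul_eq_flip G.integrable h1]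
  rfl

theorem fourierInv_toLp_ae_eq {u : V → ℂ} (h1 : Integrable u) (h2 : MemLp u 2) :
    (𝓕⁻ (h2.toLp u) : Lp ℂ 2 (volume : Measure V)) =ᵐ[volume] 𝓕⁻ u := by
  have h1' : Integrable fun x => u (-x) := h1.comp_neg
  have hcont : Continuous (𝓕⁻ u) := by
    rw [Real.fourierInv_eq_fourier_comp_neg]; exact continuous_fourier_of_integrable h1'
  refine ae_eq_of_integral_contDiff_smul_eq
    ((Lp.memLp _).locallyIntegrable one_le_two)
    hcont.locallyIntegrable fun g hg hc => ?_
  have hc' : HasCompactSupport (fun x => (g x : ℂ)) := hc.comp_left (g := fun t : ℝ => (t : ℂ)) rfl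
  let G : SchwartzMap V ℂ := hc'.toSchwartzMap (Complex.ofRealCLM.contDiff.comp hg)
  have hG : ∀ x, G x = (g x : ℂ) := fun x => rfl
  have key := congrArg (fun T => T G) (Lp.fourierInv_toTemperedDistribution_eq (h2.toLp u))
  simp only [TemperedDistribution.fourierInv_apply, Lp.toTemperedDistribution_apply, hG,
    smul_eq_mul] at key
  simp only [Complex.real_smul]
  rw [← key]
  have e1 : ∫ x, (𝓕⁻ G) x * (h2.toLp u) x = ∫ x, (𝓕 (G : V → ℂ)) x * u (-x) := by
    rw [← integral_neg_eq_self]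
    refine integral_congr_ae ?_
    have := (Measure.measurePreserving_neg
      (volume : Measure V)).quasiMeasurePreserving.ae h2.coeFn_toLp
    filter_upwards [this] with x hx
    rw [hx, SchwartzMap.fourierInv_coe, Real.fourierInv_eq_fourier_neg, neg_neg]
  rw [e1, integral_fourier_mul_eq_flip G.integrable h1', Real.fourierInv_eq_fourier_comp_neg]
  rfl

/-- Plancherel's identity for `L¹ ∩ L²`. -/
theorem lintegral_enorm_fourier_sq {u : V → ℂ} (h1 : Integrable u) (h2 : MemLp u 2) :
    ∫⁻ x, ‖𝓕 u x‖ₑ ^ 2 = ∫⁻ x, ‖u x‖ₑ ^ 2 := by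
  have hn := Lp.norm_fourier_eq (h2.toLp u)
  have aux : ∀ f : Lp ℂ 2 (volume : Measure V), ∫⁻ x, ‖f x‖ₑ ^ 2 = ‖f‖ₑ ^ 2 := by
    intro f
    have h := eLpNorm_nnreal_pow_eq_lintegral (μ := (volume : Measure V)) (f := f)
      (p := 2) two_ne_zero
    rw [Lp.enorm_def]
    simpa using h.symm
  have e1 : ∫⁻ x, ‖𝓕 u x‖ₑ ^ 2 = ‖(𝓕 (h2.toLp u) : Lp ℂ 2 (volume : Measure V))‖ₑ ^ 2 := by
    rw [← aux]
    refine lintegral_congr_ae ?_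
    filter_upwards [fourier_toLp_ae_eq h1 h2] with x hx
    rw [hx]
  have e2 : ∫⁻ x, ‖u x‖ₑ ^ 2 = ‖h2.toLp u‖ₑ ^ 2 := by
    rw [← aux]
    refine lintegral_congr_ae ?_
    filter_upwards [h2.coeFn_toLp] with x hx
    rw [hx]
  rw [e1, e2, enorm_eq_nnnorm, enorm_eq_nnnorm]
  congr 2
  exact NNReal.eq hn

end FourierL2

/-! ### A kernel of Bessel type -/

section GammaKernel

open ProbabilityTheory Set in
/-- The Gamma integral with a complex rate. Both sides are analytic in the half plane `Re z < 0`,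
and they agree on the negative real axis. -/
theorem integral_rpow_mul_cexp_Ioi {s : ℝ} (hs : 0 < s) {z : ℂ} (hz : z.re < 0) :
    ∫ t in Ioi (0 : ℝ), ((t ^ (s - 1) : ℝ) : ℂ) * Complex.exp (z * t) =
      Real.Gamma s * (-z) ^ (-(s : ℂ)) := by
  set ρ : ℝ → NNReal := fun t => (t ^ (s - 1)).toNNReal with hρ
  have hρm : Measurable ρ := by fun_prop
  set μ : Measure ℝ := (volume.restrict (Ioi (0 : ℝ))).withDensity (fun t => ρ t) with hμ
  have hρt : ∀ t ∈ Ioi (0 : ℝ), ((ρ t : ℝ)) = t ^ (s - 1) := fun t ht =>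
    Real.coe_toNNReal _ (Real.rpow_nonneg (le_of_lt ht) _)
  have hmgf : ∀ w : ℂ, complexMGF id μ w =
      ∫ t in Ioi (0 : ℝ), ((t ^ (s - 1) : ℝ) : ℂ) * Complex.exp (w * t) := by
    intro w
    rw [complexMGF, hμ, integral_withDensity_eq_integral_smul hρm]
    refine setIntegral_congr_fun measurableSet_Ioi fun t ht => ?_
    simp only [id, NNReal.smul_def, hρt t ht, Complex.real_smul]
  have hset : Iio (0 : ℝ) ⊆ integrableExpSet id μ := by
    intro y hy
    have hy' : 0 < -y := neg_pos.2 hy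
    rw [integrableExpSet, mem_ofPred_eq, hμ, integrable_withDensity_iff_integrable_smul hρm]
    have h := integrableOn_rpow_mul_exp_neg_mul_rpow (p := 1) (s := s - 1) (b := -y)
      (by linarith) one_pos hy'
    refine h.congr_fun (fun t ht => ?_) measurableSet_Ioi
    simp [NNReal.smul_def, hρt t ht]
  have hopen : {w : ℂ | w.re < 0} ⊆ {w : ℂ | w.re ∈ interior (integrableExpSet id μ)} :=
    fun w hw => interior_maximal hset isOpen_Iio hw
  have hA : AnalyticOnNhd ℂ (complexMGF id μ) {w : ℂ | w.re < 0} :=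
    analyticOnNhd_complexMGF.mono hopen
  have hB : AnalyticOnNhd ℂ (fun w : ℂ => Real.Gamma s * (-w) ^ (-(s : ℂ))) {w : ℂ | w.re < 0} := by
    refine DifferentiableOn.analyticOnNhd (fun w hw => ?_)
      (isOpen_lt Complex.continuous_re continuous_const)
    have : -w ∈ Complex.slitPlane := Or.inl (by simpa using hw)
    exact ((differentiableAt_id.neg.cpow_const this).const_mul _).differentiableWithinAt
  have hreal : ∀ y : ℝ, y < 0 → complexMGF id μ (y : ℂ) =
      Real.Gamma s * (-(y : ℂ)) ^ (-(s : ℂ)) := by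
    intro y hy
    have hy' : 0 < -y := neg_pos.2 hy
    have h := Real.integral_rpow_mul_exp_neg_mul_Ioi hs hy'
    rw [hmgf]
    have e : (∫ t in Ioi (0 : ℝ), ((t ^ (s - 1) : ℝ) : ℂ) * Complex.exp ((y : ℂ) * t)) =
        ((∫ t in Ioi (0 : ℝ), t ^ (s - 1) * Real.exp (-(-y * t)) : ℝ) : ℂ) := by
      rw [← integral_complex_ofReal]
      refine setIntegral_congr_fun measurableSet_Ioi fun t ht => ?_
      push_cast
      simp
    rw [e, h, mul_comm, Complex.ofReal_mul, ← Complex.ofReal_neg, ← Complex.ofReal_neg,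
      ← Complex.ofReal_cpow hy'.le, Real.rpow_neg hy'.le, one_div, Real.inv_rpow hy'.le]
  rw [← hmgf]
  refine AnalyticOnNhd.eqOn_of_preconnected_of_frequently_eq hA hB
    ((convex_halfSpace_re_lt 0).isPreconnected) (z₀ := ((-1 : ℝ) : ℂ)) (by simp) ?_ hz
  have hfr : ∃ᶠ y : ℝ in 𝓝[≠] (-1), complexMGF id μ (y : ℂ) =
      Real.Gamma s * (-(y : ℂ)) ^ (-(s : ℂ)) := by
    refine Eventually.frequently ?_
    filter_upwards [mem_nhdsWithin_of_mem_nhds (Iio_mem_nhds (show (-1 : ℝ) < 0 by norm_num))]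
      with y hy using hreal y hy
  have ht : Tendsto (fun y : ℝ => (y : ℂ)) (𝓝[≠] (-1)) (𝓝[≠] ((-1 : ℝ) : ℂ)) := by
    refine tendsto_nhdsWithin_iff.2 ⟨?_, ?_⟩
    · exact (Complex.continuous_ofReal.tendsto _).mono_left nhdsWithin_le_nhds
    · filter_upwards [self_mem_nhdsWithin] with y hy
      exact fun h => hy (Complex.ofReal_injective h)
  exact ht.frequently hfr

/-- The one-sided Gamma density `t₊ ^ (s - 1) e ^ (-t)`, without normalisation. -/
noncomputable def gammaKernel (s t : ℝ) : ℝ :=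
  (Set.Ioi (0 : ℝ)).indicator (fun t => t ^ (s - 1) * Real.exp (-t)) t

theorem measurable_gammaKernel (s : ℝ) : Measurable (gammaKernel s) :=
  Measurable.indicator (by fun_prop) measurableSet_Ioi

theorem integrable_gammaKernel {s : ℝ} (hs : 0 < s) : Integrable (gammaKernel s) := by
  have h := integrableOn_rpow_mul_exp_neg_mul_rpow (p := 1) (s := s - 1) (b := 1)
      (by linarith) one_pos one_pos
  refine IntegrableOn.integrable_indicator ?_ measurableSet_Ioi
  simpa using h

/-- For `s > 1 / 2` the Gamma kernel is square integrable, even with an exponential weight. -/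
theorem integrable_exp_mul_gammaKernel_sq {s : ℝ} (hs : 1 / 2 < s) :
    Integrable fun t => (Real.exp (|t| / 2) * gammaKernel s t) ^ 2 := by
  have h := integrableOn_rpow_mul_exp_neg_mul_rpow (p := 1) (s := 2 * s - 2) (b := 1)
      (by linarith) one_pos one_pos
  have h' := IntegrableOn.integrable_indicator h measurableSet_Ioi
  refine h'.congr (ae_of_all _ fun t => ?_)
  by_cases ht : t ∈ Set.Ioi (0 : ℝ)
  · have ht0 : (0 : ℝ) < t := ht
    simp only [gammaKernel, Set.indicator_of_mem ht, abs_of_pos ht0, mul_pow, ← Real.rpow_natCast]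
    rw [← Real.rpow_mul ht0.le, ← Real.exp_mul, ← Real.exp_mul, mul_left_comm, ← Real.exp_add,
      Real.rpow_one]
    push_cast
    congr 1 <;> ring_nf
  · simp [gammaKernel, Set.indicator_of_notMem ht]

/-- The inverse Fourier transform of the Gamma kernel is `Γ(s) (1 - 2 π i x) ^ (-s)`; only its
modulus is needed. -/
theorem norm_sq_integral_gammaKernel {s : ℝ} (hs : 0 < s) (x : ℝ) :
    ‖∫ t, Complex.exp ((2 * Real.pi * (t * x) : ℝ) * Complex.I) * (gammaKernel s t : ℂ)‖ ^ 2 =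
      Real.Gamma s ^ 2 * ((1 + (2 * Real.pi * x) ^ 2) ^ s)⁻¹ := by
  set z : ℂ := -1 + (2 * Real.pi * x : ℝ) * Complex.I with hz
  have hre : z.re = -1 := by simp [hz]
  have him : z.im = 2 * Real.pi * x := by simp [hz]
  have e : (∫ t, Complex.exp ((2 * Real.pi * (t * x) : ℝ) * Complex.I) * (gammaKernel s t : ℂ)) =
      ∫ t in Set.Ioi (0 : ℝ), ((t ^ (s - 1) : ℝ) : ℂ) * Complex.exp (z * t) := by
    rw [← integral_indicator measurableSet_Ioi]
    refine integral_congr_ae (ae_of_all _ fun t => ?_)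
    by_cases ht : t ∈ Set.Ioi (0 : ℝ)
    · simp only [gammaKernel, Set.indicator_of_mem ht]
      rw [Complex.ofReal_mul (t ^ (s - 1)), Complex.ofReal_exp, mul_left_comm,
        ← Complex.exp_add, hz]
      congr 2
      push_cast
      ring
    · simp [gammaKernel, Set.indicator_of_notMem ht]
  rw [e, integral_rpow_mul_cexp_Ioi hs (by rw [hre]; norm_num), norm_mul, mul_pow]
  have hn : ‖-z‖ ^ 2 = 1 + (2 * Real.pi * x) ^ 2 := by
    rw [norm_neg, ← Complex.normSq_eq_norm_sq, Complex.normSq_apply, hre, him]; ring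
  have hz0 : -z ≠ 0 := fun h => by
    have := congrArg Complex.re h
    simp [hre] at this
  congr 1
  · simp
  · rw [← Complex.ofReal_neg, Complex.norm_cpow_real, Real.rpow_neg (norm_nonneg _), inv_pow, ← hn,
      ← Real.rpow_natCast, ← Real.rpow_mul (norm_nonneg _), ← Real.rpow_natCast ‖-z‖,
      ← Real.rpow_mul (norm_nonneg _), mul_comm s]

theorem EuclideanSpace.norm_le_sum_abs {d : ℕ} (x : EuclideanSpace ℝ (Fin d)) :
    ‖x‖ ≤ ∑ j, |x j| := by
  rw [EuclideanSpace.norm_eq]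
  refine Real.sqrt_le_iff.2 ⟨Finset.sum_nonneg fun _ _ => abs_nonneg _, ?_⟩
  exact Finset.sum_sq_le_sq_sum_of_nonneg fun _ _ => abs_nonneg _

theorem integral_euclideanSpace_prod {d : ℕ} (f : Fin d → ℝ → ℂ) :
    ∫ x : EuclideanSpace ℝ (Fin d), ∏ j, f j (x j) = ∏ j, ∫ t, f j t := by
  rw [← integral_fintype_prod_volume_eq_prod]
  exact (PiLp.volume_preserving_ofLp (Fin d)).integral_comp
    (MeasurableEquiv.toLp 2 (Fin d → ℝ)).symm.measurableEmbedding (fun y => ∏ j, f j (y j))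

theorem integrable_euclideanSpace_prod {d : ℕ} {f : ℝ → ℝ} (hf : Integrable f) :
    Integrable fun x : EuclideanSpace ℝ (Fin d) => ∏ j, f (x j) :=
  ((PiLp.volume_preserving_ofLp (Fin d)).integrable_comp_emb
    (MeasurableEquiv.toLp 2 (Fin d → ℝ)).symm.measurableEmbedding
    (g := fun y : Fin d → ℝ => ∏ j, f (y j))).2 (Integrable.fintype_prod fun _ => hf)

/-- A Bessel-type kernel: an integrable function, square integrable with an exponential weight,
whose Fourier transform is bounded below by a multiple of `(1 + ‖x‖²) ^ (-m / 2)`. Such a kernel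
exists as soon as `2 m > d`: a tensor product of Gamma kernels of exponent `m / d > 1 / 2`. -/
theorem exists_besselKernel {d m : ℕ} [NeZero d] (hm : d < 2 * m) :
    ∃ (G : EuclideanSpace ℝ (Fin d) → ℝ) (C : ℝ), 0 < C ∧ Integrable G ∧
      MemLp (fun z => Real.exp (‖z‖ / 2) * G z) 2 ∧
      ∀ x, 1 ≤ C * (1 + ‖x‖ ^ 2) ^ m * ‖𝓕⁻ (fun z => (G z : ℂ)) x‖ ^ 2 := by
  have hd : (0 : ℝ) < d := by exact_mod_cast Nat.pos_of_ne_zero (NeZero.ne d)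
  set s : ℝ := m / d with hs
  have hs2 : 1 / 2 < s := by
    rw [hs, div_lt_div_iff₀ two_pos hd]
    have : (d : ℝ) < 2 * m := by exact_mod_cast hm
    linarith
  have hs0 : 0 < s := by linarith
  have hΓ : 0 < Real.Gamma s := Real.Gamma_pos_of_pos hs0
  refine ⟨fun z => ∏ j, gammaKernel s (z j),
    (4 * Real.pi ^ 2) ^ m * ((Real.Gamma s ^ 2) ^ d)⁻¹, by positivity,
    integrable_euclideanSpace_prod (integrable_gammaKernel hs0), ?_, ?_⟩
  · have hmeas : Measurable fun z : EuclideanSpace ℝ (Fin d) => ∏ j, gammaKernel s (z j) :=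
      Finset.measurable_prod _ fun j _ => (measurable_gammaKernel s).comp (by fun_prop)
    rw [memLp_two_iff_integrable_sq (by fun_prop)]
    refine (integrable_euclideanSpace_prod (d := d) (integrable_exp_mul_gammaKernel_sq hs2)).mono'
      (by fun_prop) (ae_of_all _ fun z => ?_)
    rw [Real.norm_eq_abs, abs_of_nonneg (sq_nonneg _), Finset.prod_pow, Finset.prod_mul_distrib,
      mul_pow, mul_pow, ← Real.exp_sum, ← Finset.sum_div]
    gcongr
    exact EuclideanSpace.norm_le_sum_abs z
  · intro x
    have e : 𝓕⁻ (fun z : EuclideanSpace ℝ (Fin d) => ((∏ j, gammaKernel s (z j) : ℝ) : ℂ)) x =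
        ∏ j, ∫ t, Complex.exp ((2 * Real.pi * (t * x j) : ℝ) * Complex.I) *
          (gammaKernel s t : ℂ) := by
      rw [Real.fourierInv_eq', ← integral_euclideanSpace_prod]
      refine integral_congr_ae (ae_of_all _ fun z => ?_)
      simp only [smul_eq_mul]
      rw [Finset.prod_mul_distrib, ← Complex.exp_sum, ← Finset.sum_mul, PiLp.inner_apply]
      congr 3
      · rw [← Complex.ofReal_sum, Finset.mul_sum]
        simp [mul_comm]
      · push_cast; rfl
    rw [e, norm_prod, ← Finset.prod_pow]
    simp_rw [norm_sq_integral_gammaKernel hs0]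
    rw [Finset.prod_mul_distrib, Finset.prod_const, Finset.card_univ, Fintype.card_fin,
      Finset.prod_inv_distrib]
    have hle : ∏ j, (1 + (2 * Real.pi * x j) ^ 2) ^ s ≤
        (4 * Real.pi ^ 2) ^ m * (1 + ‖x‖ ^ 2) ^ m := by
      calc ∏ j, (1 + (2 * Real.pi * x j) ^ 2) ^ s
          ≤ ∏ _j : Fin d, (4 * Real.pi ^ 2 * (1 + ‖x‖ ^ 2)) ^ s := by
            refine Finset.prod_le_prod (fun j _ => by positivity) fun j _ => ?_
            have hx : (x j) ^ 2 ≤ ‖x‖ ^ 2 := by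
              have := PiLp.norm_apply_le x j
              rw [Real.norm_eq_abs] at this
              exact sq_le_sq' (by linarith [neg_abs_le (x j)]) ((le_abs_self _).trans this)
            have hpi : 1 ≤ 4 * Real.pi ^ 2 := by nlinarith [Real.pi_gt_three]
            refine Real.rpow_le_rpow (by positivity) ?_ hs0.le
            nlinarith [Real.pi_pos, sq_nonneg Real.pi]
        _ = _ := by
            rw [Finset.prod_const, Finset.card_univ, Fintype.card_fin, ← Real.rpow_mul_natCast
              (by positivity), hs, div_mul_cancel₀ _ hd.ne', Real.rpow_natCast, mul_pow]
    have hpos : 0 < ∏ j, (1 + (2 * Real.pi * x j) ^ 2) ^ s :=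
      Finset.prod_pos fun j _ => by positivity
    calc (1 : ℝ) = (∏ j, (1 + (2 * Real.pi * x j) ^ 2) ^ s) *
          (∏ j, (1 + (2 * Real.pi * x j) ^ 2) ^ s)⁻¹ := (mul_inv_cancel₀ hpos.ne').symm
      _ ≤ ((4 * Real.pi ^ 2) ^ m * (1 + ‖x‖ ^ 2) ^ m) *
          (∏ j, (1 + (2 * Real.pi * x j) ^ 2) ^ s)⁻¹ := by gcongr
      _ = _ := by field_simp

end GammaKernel

/-! ### Weighted `L²` estimates for translates of a kernel -/

section Translation

variable {V : Type*} [NormedAddCommGroup V] [InnerProductSpace ℝ V] [FiniteDimensional ℝ V]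
  [MeasurableSpace V] [BorelSpace V]

/-- Translations are continuous in `L²`. -/
theorem tendsto_eLpNorm_sub_translate {H : V → ℝ} (hH : MemLp H 2) :
    Tendsto (fun h : V => eLpNorm (fun z => H z - H (z - h)) 2 volume) (𝓝 0) (𝓝 0) := by
  let τ : V → C(V, V) := fun h => ⟨fun z => z - h, by fun_prop⟩
  have hτ : Continuous τ := ContinuousMap.continuous_of_continuous_uncurry _ (by
    simp only [τ]; exact continuous_snd.sub continuous_fst)
  have hmp : ∀ h, MeasurePreserving (τ h) volume volume := fun h =>
    measurePreserving_sub_right volume h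
  have hc : Continuous fun h => Lp.compMeasurePreserving (τ h) (hmp h) (hH.toLp H) :=
    continuous_const.compMeasurePreservingLp hτ hmp (by simp)
  have h0 : Lp.compMeasurePreserving (τ 0) (hmp 0) (hH.toLp H) = hH.toLp H := by
    refine Lp.ext ((Lp.coeFn_compMeasurePreserving _ (hmp 0)).trans ?_)
    simp [τ, Function.comp_def]
  have ht := (continuous_const (y := hH.toLp H)).edist hc |>.tendsto 0
  rw [h0, edist_self] at ht
  refine ht.congr fun h => ?_
  rw [Lp.edist_def]
  refine eLpNorm_congr_ae ?_
  filter_upwards [hH.coeFn_toLp, Lp.coeFn_compMeasurePreserving (hH.toLp H) (hmp h),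
    (hmp h).quasiMeasurePreserving.ae hH.coeFn_toLp] with z h1 h2 h3
  simp only [Pi.sub_apply, h1, h2, Function.comp_apply]
  rw [h3]
  rfl

theorem lintegral_enorm_sq_eq_eLpNorm_sq {E : Type*} [NormedAddCommGroup E] (f : V → E) :
    ∫⁻ x, ‖f x‖ₑ ^ 2 = eLpNorm f 2 volume ^ 2 := by
  have h := eLpNorm_nnreal_pow_eq_lintegral (μ := (volume : Measure V)) (f := f)
    (p := 2) two_ne_zero
  simpa using h.symm

/-- The weighted `L²` modulus of continuity `∫ |G z - G (z - h)|² e ^ ‖z‖ dz` of a kernel. -/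
noncomputable def kernelModulus (G : V → ℝ) (h : V) : ℝ≥0∞ :=
  ∫⁻ z, ‖Real.exp (‖z‖ / 2) * (G z - G (z - h))‖ₑ ^ 2

theorem abs_one_sub_exp_half_norm_le {W : Type*} [SeminormedAddCommGroup W] (z h : W) :
    ‖1 - Real.exp ((‖z‖ - ‖z - h‖) / 2)‖ ≤ Real.exp (‖h‖ / 2) - 1 := by
  have h1 : (‖z‖ - ‖z - h‖) / 2 ≤ ‖h‖ / 2 := by
    have := norm_sub_norm_le z (z - h)
    rw [sub_sub_cancel] at this
    linarith
  have h2 : -(‖h‖ / 2) ≤ (‖z‖ - ‖z - h‖) / 2 := by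
    have := norm_sub_le z h
    linarith
  have h3 := Real.exp_le_exp.2 h1
  have h4 := Real.exp_le_exp.2 h2
  have h5 : 2 ≤ Real.exp (‖h‖ / 2) + Real.exp (-(‖h‖ / 2)) := by
    have := Real.one_le_cosh (‖h‖ / 2)
    rw [Real.cosh_eq] at this
    linarith
  rw [Real.norm_eq_abs, abs_le]
  constructor <;> linarith

/-- The translate of the weighted kernel and the weighted translate of the kernel differ by the
factor `e ^ ((‖z‖ - ‖z - h‖) / 2)`, which is close to `1` uniformly in `z`. -/
theorem kernelModulus_le {G : V → ℝ} (hG : MemLp (fun z => Real.exp (‖z‖ / 2) * G z) 2) (h : V) :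
    kernelModulus G h ≤ (eLpNorm (fun z => Real.exp (‖z‖ / 2) * G z -
      Real.exp (‖z - h‖ / 2) * G (z - h)) 2 volume +
      ENNReal.ofReal (Real.exp (‖h‖ / 2) - 1) *
        eLpNorm (fun z => Real.exp (‖z‖ / 2) * G z) 2 volume) ^ 2 := by
  have hmp : MeasurePreserving (fun z : V => z - h) volume volume :=
    measurePreserving_sub_right volume h
  have hHh : MemLp (fun z => Real.exp (‖z - h‖ / 2) * G (z - h)) 2 :=
    hG.comp_measurePreserving hmp
  have hnorm : eLpNorm (fun z => Real.exp (‖z - h‖ / 2) * G (z - h)) 2 volume =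
      eLpNorm (fun z => Real.exp (‖z‖ / 2) * G z) 2 volume :=
    eLpNorm_comp_measurePreserving (f := fun z : V => z - h)
      (g := fun z => Real.exp (‖z‖ / 2) * G z) hG.aestronglyMeasurable hmp
  have hexp : Measurable fun z : V => 1 - Real.exp ((‖z‖ - ‖z - h‖) / 2) := by fun_prop
  have e : (fun z => Real.exp (‖z‖ / 2) * (G z - G (z - h))) =
      (fun z => Real.exp (‖z‖ / 2) * G z - Real.exp (‖z - h‖ / 2) * G (z - h)) +
        (fun z => 1 - Real.exp ((‖z‖ - ‖z - h‖) / 2)) *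
          fun z => Real.exp (‖z - h‖ / 2) * G (z - h) := by
    ext z
    have : Real.exp (‖z‖ / 2) = Real.exp ((‖z‖ - ‖z - h‖) / 2) * Real.exp (‖z - h‖ / 2) := by
      rw [← Real.exp_add]; ring_nf
    simp only [Pi.add_apply, Pi.mul_apply]
    linear_combination (-G (z - h)) * this
  have m1 := hG.1.sub hHh.1
  have m2 := hexp.aestronglyMeasurable.mul (μ := volume) hHh.1
  have hle := eLpNorm_le_mul_eLpNorm_of_ae_le_mul (μ := volume)
    (f := (fun z => 1 - Real.exp ((‖z‖ - ‖z - h‖) / 2)) *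
          fun z => Real.exp (‖z - h‖ / 2) * G (z - h))
    (g := fun z => Real.exp (‖z - h‖ / 2) * G (z - h)) (c := Real.exp (‖h‖ / 2) - 1)
    (ae_of_all _ fun z => by
      rw [Pi.mul_apply, norm_mul]
      exact mul_le_mul_of_nonneg_right (abs_one_sub_exp_half_norm_le z h) (norm_nonneg _)) 2
  rw [hnorm] at hle
  rw [kernelModulus, lintegral_enorm_sq_eq_eLpNorm_sq, e]
  exact pow_le_pow_left' ((eLpNorm_add_le m1 m2 one_le_two).trans (add_le_add le_rfl hle)) 2

theorem tendsto_kernelModulus {G : V → ℝ} (hG : MemLp (fun z => Real.exp (‖z‖ / 2) * G z) 2) :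
    Tendsto (kernelModulus G) (𝓝 0) (𝓝 0) := by
  have h1 : Tendsto (fun h : V => ENNReal.ofReal (Real.exp (‖h‖ / 2) - 1)) (𝓝 0) (𝓝 0) := by
    have : Continuous fun h : V => ENNReal.ofReal (Real.exp (‖h‖ / 2) - 1) :=
      ENNReal.continuous_ofReal.comp (by fun_prop)
    simpa using this.tendsto 0
  have h2 := ENNReal.Tendsto.mul_const
    (b := eLpNorm (fun z => Real.exp (‖z‖ / 2) * G z) 2 volume) h1 (Or.inr hG.2.ne)
  have h3 := (tendsto_eLpNorm_sub_translate hG).add h2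
  have h4 := ((ENNReal.continuous_pow 2).tendsto _).comp h3
  rw [zero_mul, add_zero, zero_pow two_ne_zero] at h4
  exact tendsto_of_tendsto_of_tendsto_of_le_of_le tendsto_const_nhds h4
    (fun _ => zero_le) (kernelModulus_le hG)

/-- The Cauchy–Schwarz inequality. -/
theorem enorm_integral_mul_sq_le {f g : V → ℂ} (hf : AEStronglyMeasurable f)
    (hg : AEStronglyMeasurable g) :
    ‖∫ x, f x * g x‖ₑ ^ 2 ≤ (∫⁻ x, ‖f x‖ₑ ^ 2) * ∫⁻ x, ‖g x‖ₑ ^ 2 := by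
  have h1 : ‖∫ x, f x * g x‖ₑ ≤ ∫⁻ x, ‖f x‖ₑ * ‖g x‖ₑ := by
    refine (enorm_integral_le_lintegral_enorm _).trans_eq ?_
    simp only [enorm_mul]
  have h2 := ENNReal.lintegral_mul_le_Lp_mul_Lq (volume : Measure V) (p := 2) (q := 2)
    Real.HolderConjugate.two_two hf.enorm hg.enorm
  calc ‖∫ x, f x * g x‖ₑ ^ 2
      ≤ ((∫⁻ x, ‖f x‖ₑ ^ (2 : ℝ)) ^ (1 / 2 : ℝ) * (∫⁻ x, ‖g x‖ₑ ^ (2 : ℝ)) ^ (1 / 2 : ℝ)) ^ 2 := by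
        gcongr
        exact h1.trans h2
    _ = _ := by
        rw [mul_pow, ← ENNReal.rpow_natCast, ← ENNReal.rpow_natCast, ← ENNReal.rpow_mul,
          ← ENNReal.rpow_mul]
        norm_num

/-- The exponential weight `e ^ (-‖z‖)`. -/
noncomputable def expWeight {W : Type*} [Norm W] (z : W) : ℝ≥0∞ := ENNReal.ofReal (Real.exp (-‖z‖))

theorem measurable_expWeight {W : Type*} [SeminormedAddCommGroup W] [MeasurableSpace W]
    [OpensMeasurableSpace W] : Measurable (expWeight : W → ℝ≥0∞) := by
  unfold expWeight; fun_prop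

theorem expWeight_le {W : Type*} [SeminormedAddCommGroup W] (z w : W) :
    expWeight z ≤ ENNReal.ofReal (Real.exp ‖z - w‖) * expWeight w := by
  rw [expWeight, expWeight, ← ENNReal.ofReal_mul (Real.exp_nonneg _), ← Real.exp_add]
  refine ENNReal.ofReal_le_ofReal (Real.exp_le_exp.2 ?_)
  have := norm_sub_norm_le w z
  rw [norm_sub_rev] at this
  linarith

theorem lintegral_expWeight_lt_top : ∫⁻ z : V, expWeight z < ⊤ := by
  set n := Module.finrank ℝ V + 1 with hn
  have hi : Integrable (fun x : V => (1 + ‖x‖) ^ (-(n : ℝ))) :=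
    integrable_one_add_norm (by rw [hn]; push_cast; linarith)
  have hle : ∀ z : V, expWeight z ≤
      ENNReal.ofReal (n.factorial * Real.exp 1) * ‖(1 + ‖z‖) ^ (-(n : ℝ))‖ₑ := by
    intro z
    have hp : 0 < 1 + ‖z‖ := by positivity
    rw [Real.enorm_of_nonneg (by positivity), ← ENNReal.ofReal_mul (by positivity), expWeight]
    refine ENNReal.ofReal_le_ofReal ?_
    have := Real.pow_div_factorial_le_exp (1 + ‖z‖) hp.le n
    rw [div_le_iff₀ (by positivity), Real.exp_add] at this
    rw [Real.rpow_neg hp.le, Real.rpow_natCast, ← div_eq_mul_inv, le_div_iff₀ (by positivity),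
      Real.exp_neg, inv_mul_le_iff₀ (Real.exp_pos _)]
    linarith
  refine (lintegral_mono hle).trans_lt ?_
  rw [lintegral_const_mul' _ _ ENNReal.ofReal_ne_top]
  exact ENNReal.mul_lt_top ENNReal.ofReal_lt_top hi.2

/-- Weighted Cauchy–Schwarz inequality for a convolution. The weight `expWeight` localizes `Γ` near
`η`, so that the right-hand side can be summed or integrated over `η`. -/
theorem enorm_integral_translate_mul_sq_le {K : V → ℝ} (hK : AEStronglyMeasurable K) {Γ : V → ℂ}
    (hΓ : AEStronglyMeasurable Γ) (η : V) :
    ‖∫ z, (K (z - η) : ℂ) * Γ z‖ₑ ^ 2 ≤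
      (∫⁻ z, ‖Real.exp (‖z‖ / 2) * K z‖ₑ ^ 2) * ∫⁻ z, expWeight (z - η) * ‖Γ z‖ₑ ^ 2 := by
  have hKη : AEStronglyMeasurable fun z => K (z - η) :=
    hK.comp_measurePreserving (measurePreserving_sub_right volume η)
  have e : ∫ z, (K (z - η) : ℂ) * Γ z =
      ∫ z, ((Real.exp (‖z - η‖ / 2) * K (z - η) : ℝ) : ℂ) *
        (((Real.exp (-‖z - η‖ / 2) : ℝ) : ℂ) * Γ z) := by
    refine integral_congr_ae (ae_of_all _ fun z => ?_)
    have : (((Real.exp (‖z - η‖ / 2) : ℝ) : ℂ)) * ((Real.exp (-‖z - η‖ / 2) : ℝ) : ℂ) = 1 := by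
      rw [← Complex.ofReal_mul, ← Real.exp_add]
      simp [neg_div]
    simp only [Complex.ofReal_mul]
    linear_combination (-(K (z - η) : ℂ) * Γ z) * this
  have m1 : Measurable fun z : V => Real.exp (‖z - η‖ / 2) := by fun_prop
  have m2 : Measurable fun z : V => ((Real.exp (-‖z - η‖ / 2) : ℝ) : ℂ) := by fun_prop
  rw [e]
  refine (enorm_integral_mul_sq_le (Complex.continuous_ofReal.comp_aestronglyMeasurable
    (m1.aestronglyMeasurable.mul hKη)) (m2.aestronglyMeasurable.mul hΓ)).trans_eq ?_
  congr 1
  · rw [← lintegral_sub_right_eq_self (fun z => ‖Real.exp (‖z‖ / 2) * K z‖ₑ ^ 2) η]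
    refine lintegral_congr fun z => ?_
    rw [← ofReal_norm, ← ofReal_norm, Complex.norm_real]
    rfl
  · refine lintegral_congr fun z => ?_
    rw [Pi.mul_apply, enorm_mul, mul_pow]
    congr 1
    rw [← ofReal_norm, Complex.norm_real, Real.norm_eq_abs, abs_of_pos (Real.exp_pos _),
      ← ENNReal.ofReal_pow (Real.exp_nonneg _), expWeight, ← Real.exp_nat_mul]
    congr 2
    push_cast
    ring

end Translation

/-! ### Sobolev norms on the Fourier side -/

section Sampling

variable {d : ℕ}

/-- The squared norm `∫ (1 + ‖x‖²) ^ k |u|²`, which on the Fourier side is a Sobolev norm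
of order `k`. -/
noncomputable def sobolevNormSq (k : ℕ) (u : EuclideanSpace ℝ (Fin d) → ℂ) : ℝ≥0∞ :=
  ∫⁻ x, ENNReal.ofReal ((1 + ‖x‖ ^ 2) ^ k) * ‖u x‖ₑ ^ 2

theorem lintegral_enorm_sq_le_sobolevNormSq (k : ℕ) (u : EuclideanSpace ℝ (Fin d) → ℂ) :
    ∫⁻ x, ‖u x‖ₑ ^ 2 ≤ sobolevNormSq k u := by
  refine lintegral_mono fun x => ?_
  have : (1 : ℝ≥0∞) ≤ ENNReal.ofReal ((1 + ‖x‖ ^ 2) ^ k) :=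
    ENNReal.one_le_ofReal.2 (one_le_pow₀ (by nlinarith [sq_nonneg ‖x‖]))
  simpa using mul_le_mul_left this (‖u x‖ₑ ^ 2)

theorem memLp_two_of_lintegral_lt_top {u : EuclideanSpace ℝ (Fin d) → ℂ}
    (hu : AEStronglyMeasurable u) (h : ∫⁻ x, ‖u x‖ₑ ^ 2 < ⊤) : MemLp u 2 := by
  refine ⟨hu, ?_⟩
  rw [lintegral_enorm_sq_eq_eLpNorm_sq] at h
  exact (ENNReal.pow_lt_top_iff.1 h).resolve_right two_ne_zero

theorem memLp_of_sobolevNormSq_lt_top {k : ℕ} {u : EuclideanSpace ℝ (Fin d) → ℂ}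
    (hu : AEStronglyMeasurable u) (h : sobolevNormSq k u < ⊤) : MemLp u 2 :=
  memLp_two_of_lintegral_lt_top hu ((lintegral_enorm_sq_le_sobolevNormSq k u).trans_lt h)

theorem integrable_one_add_norm_sq_pow_inv {k : ℕ} (hk : d < 2 * k) :
    Integrable fun x : EuclideanSpace ℝ (Fin d) => ((1 + ‖x‖ ^ 2) ^ k)⁻¹ := by
  have h := integrable_rpow_neg_one_add_norm_sq (E := EuclideanSpace ℝ (Fin d)) (μ := volume)
    (r := (2 * k : ℕ)) (by rw [finrank_euclideanSpace_fin]; exact_mod_cast hk)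
  refine h.congr (ae_of_all _ fun x => ?_)
  have : (-((2 * k : ℕ) : ℝ) / 2) = -(k : ℝ) := by push_cast; ring
  simp only [this]
  rw [Real.rpow_neg (by positivity), Real.rpow_natCast]

/-- On the Fourier side, the embedding of a Sobolev space of order larger than `d / 2` into the
bounded continuous functions, by `|u| ≤ w⁻¹ + w |u|²` with `w = (1 + ‖x‖²) ^ k`. -/
theorem integrable_of_sobolevNormSq_lt_top {k : ℕ} (hk : d < 2 * k)
    {u : EuclideanSpace ℝ (Fin d) → ℂ} (hu : AEStronglyMeasurable u)
    (h : sobolevNormSq k u < ⊤) : Integrable u := by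
  have h1 : Integrable fun x => (1 + ‖x‖ ^ 2) ^ k * ‖u x‖ ^ 2 := by
    refine ⟨by fun_prop, ?_⟩
    rw [HasFiniteIntegral]
    convert! h using 1
    refine lintegral_congr fun x => ?_
    rw [enorm_mul, enorm_pow ‖u x‖, enorm_norm, Real.enorm_of_nonneg (by positivity)]
  refine ((integrable_one_add_norm_sq_pow_inv hk).add h1).mono' hu (ae_of_all _ fun x => ?_)
  have hp : 0 < (1 + ‖x‖ ^ 2) ^ k := by positivity
  simp only [Pi.add_apply]
  set p := (1 + ‖x‖ ^ 2) ^ k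
  have h3 : p⁻¹ + p * ‖u x‖ ^ 2 - ‖u x‖ = p * ((‖u x‖ - p⁻¹ / 2) ^ 2) + 3 / 4 * p⁻¹ := by
    field_simp; ring
  have : 0 ≤ p * ((‖u x‖ - p⁻¹ / 2) ^ 2) + 3 / 4 * p⁻¹ := by positivity
  linarith

open scoped ComplexConjugate in
/-- A function of finite Sobolev norm is, on the Fourier side, the convolution of the Bessel kernel
with an `L²` function. -/
theorem exists_fourier_eq_integral_kernel {m : ℕ}
    {G : EuclideanSpace ℝ (Fin d) → ℝ} {C : ℝ} (hG1 : Integrable G)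
    (hG2 : MemLp (fun z => Real.exp (‖z‖ / 2) * G z) 2)
    (hC : ∀ x, 1 ≤ C * (1 + ‖x‖ ^ 2) ^ m * ‖𝓕⁻ (fun z => (G z : ℂ)) x‖ ^ 2)
    {u : EuclideanSpace ℝ (Fin d) → ℂ} (hu : AEStronglyMeasurable u)
    (hN : sobolevNormSq m u < ⊤) :
    ∃ Γ : EuclideanSpace ℝ (Fin d) → ℂ, MemLp Γ 2 ∧
      ∫⁻ z, ‖Γ z‖ₑ ^ 2 ≤ ENNReal.ofReal C * sobolevNormSq m u ∧
      ∀ η, 𝓕 u η = ∫ z, (G (z - η) : ℂ) * Γ z := by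
  set a : EuclideanSpace ℝ (Fin d) → ℂ := 𝓕⁻ (fun z => (G z : ℂ)) with ha
  have hGc : Integrable fun z => (G z : ℂ) := hG1.ofReal
  have hacont : Continuous a := by
    rw [ha, Real.fourierInv_eq_fourier_comp_neg]
    exact continuous_fourier_of_integrable hGc.comp_neg
  have ha0 : ∀ x, a x ≠ 0 := fun x h => by
    have := hC x
    rw [h] at this
    norm_num at this
  have hC0 : 0 ≤ C := by
    by_contra hneg
    have := hC 0
    have h2 : C * (1 + ‖(0 : EuclideanSpace ℝ (Fin d))‖ ^ 2) ^ m * ‖a 0‖ ^ 2 ≤ 0 :=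
      mul_nonpos_of_nonpos_of_nonneg
        (mul_nonpos_of_nonpos_of_nonneg (not_le.1 hneg).le (by positivity)) (by positivity)
    linarith
  -- Since `u = conj a * g` and `a` is the inverse Fourier transform of `G`, the function `Γ = 𝓕 g`
  -- has the required property by Parseval's identity.
  set g : EuclideanSpace ℝ (Fin d) → ℂ := fun x => (conj (a x))⁻¹ * u x with hg
  have hgm : AEStronglyMeasurable g := by
    refine AEStronglyMeasurable.mul ?_ hu
    exact (Continuous.inv₀ (Complex.continuous_conj.comp hacont)
      (fun x => by simpa using ha0 x)).aestronglyMeasurable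
  have hgN : ∫⁻ x, ‖g x‖ₑ ^ 2 ≤ ENNReal.ofReal C * sobolevNormSq m u := by
    rw [sobolevNormSq, ← lintegral_const_mul' _ _ ENNReal.ofReal_ne_top]
    refine lintegral_mono fun x => ?_
    simp only [hg]
    rw [enorm_mul, mul_pow, ← mul_assoc]
    gcongr
    rw [← ENNReal.ofReal_mul hC0, ← ofReal_norm, ← ENNReal.ofReal_pow (norm_nonneg _)]
    refine ENNReal.ofReal_le_ofReal ?_
    rw [norm_inv, RCLike.norm_conj, inv_pow,
      inv_le_iff_one_le_mul₀ (by have := norm_pos_iff.2 (ha0 x); positivity)]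
    exact hC x
  have hgL : MemLp g 2 := memLp_two_of_lintegral_lt_top hgm
    (hgN.trans_lt (ENNReal.mul_lt_top ENNReal.ofReal_lt_top hN))
  refine ⟨(𝓕 (hgL.toLp g) : Lp ℂ 2 (volume : Measure (EuclideanSpace ℝ (Fin d)))), Lp.memLp _,
    ?_, fun η => ?_⟩
  · refine le_of_eq_of_le ?_ hgN
    have h : ‖(𝓕 (hgL.toLp g) : Lp ℂ 2 (volume : Measure (EuclideanSpace ℝ (Fin d))))‖ₑ =
        ‖hgL.toLp g‖ₑ := by
      rw [← ofReal_norm, ← ofReal_norm, Lp.norm_fourier_eq]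
    rw [lintegral_enorm_sq_eq_eLpNorm_sq, lintegral_enorm_sq_eq_eLpNorm_sq, ← Lp.enorm_def, h,
      Lp.enorm_toLp]
  · have hG2' : MemLp (fun z => (G z : ℂ)) 2 := by
      refine (hG2.of_le hG1.1 (ae_of_all _ fun z => ?_)).ofReal
      rw [norm_mul, Real.norm_of_nonneg (Real.exp_nonneg _)]
      exact le_mul_of_one_le_left (norm_nonneg _) (Real.one_le_exp (by positivity))
    have hmp : MeasurePreserving (fun z : EuclideanSpace ℝ (Fin d) => z - η) volume volume :=
      measurePreserving_sub_right volume η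
    have hη1 : Integrable fun z => (G (z - η) : ℂ) := hGc.comp_sub_right η
    have hη2 : MemLp (fun z => (G (z - η) : ℂ)) 2 := hG2'.comp_measurePreserving hmp
    have hΦ : ∀ x, 𝓕⁻ (fun z => (G (z - η) : ℂ)) x =
        Complex.exp ((2 * Real.pi * ⟪x, η⟫ : ℝ) * Complex.I) * a x := by
      intro x
      rw [ha, Real.fourierInv_eq', Real.fourierInv_eq', ← integral_const_mul,
        ← integral_add_right_eq_self _ η]
      refine integral_congr_ae (ae_of_all _ fun z => ?_)
      simp only [add_sub_cancel_right, smul_eq_mul]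
      rw [← mul_assoc, ← Complex.exp_add, inner_add_left, real_inner_comm x η]
      congr 2
      push_cast
      ring
    have key := Lp.inner_fourier_eq (𝓕⁻ (hη2.toLp _)) (hgL.toLp g)
    rw [FourierTransform.fourier_fourierInv_eq, L2.inner_def, L2.inner_def] at key
    have e1 : ∫ z, inner ℂ ((hη2.toLp _) z)
          ((𝓕 (hgL.toLp g) : Lp ℂ 2 (volume : Measure (EuclideanSpace ℝ (Fin d)))) z) =
        ∫ z, (G (z - η) : ℂ) *
          (𝓕 (hgL.toLp g) : Lp ℂ 2 (volume : Measure (EuclideanSpace ℝ (Fin d)))) z := by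
      refine integral_congr_ae ?_
      filter_upwards [hη2.coeFn_toLp] with z hz
      rw [hz, RCLike.inner_apply, Complex.conj_ofReal, mul_comm]
    have e2 : ∫ x, inner ℂ
        ((𝓕⁻ (hη2.toLp _) : Lp ℂ 2 (volume : Measure (EuclideanSpace ℝ (Fin d)))) x)
        ((hgL.toLp g) x) = 𝓕 u η := by
      rw [Real.fourier_eq']
      refine integral_congr_ae ?_
      filter_upwards [hgL.coeFn_toLp, fourierInv_toLp_ae_eq hη1 hη2] with x hx hx2
      rw [hx, hx2, hΦ, RCLike.inner_apply, map_mul, ← Complex.exp_conj, map_mul,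
        Complex.conj_ofReal, Complex.conj_I, smul_eq_mul]
      simp only [hg]
      have hne : conj (a x) ≠ 0 := by simpa using ha0 x
      field_simp
      congr 2
      push_cast
      ring
    rw [← e1, ← e2, key]

/-! ### Values of the Fourier transform at separated or dense points -/

/-- The sum of the exponential weights centred at separated points is bounded by the integral of the
weight over the disjoint balls of radius `δ / 2` around these points. -/
theorem sum_expWeight_le {ι : Type*} {y : ι → EuclideanSpace ℝ (Fin d)} {δ : ℝ} (hδ : 0 < δ)
    (hy : Pairwise fun i j => δ ≤ dist (y i) (y j)) (s : Finset ι) (z : EuclideanSpace ℝ (Fin d)) :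
    ∑ ν ∈ s, expWeight (z - y ν) ≤
      (volume (Metric.ball (0 : EuclideanSpace ℝ (Fin d)) (δ / 2)))⁻¹ *
        (ENNReal.ofReal (Real.exp (δ / 2)) *
          ∫⁻ w : EuclideanSpace ℝ (Fin d), expWeight w) := by
  set b : ℝ≥0∞ := volume (Metric.ball (0 : EuclideanSpace ℝ (Fin d)) (δ / 2)) with hb
  have hb0 : b ≠ 0 := (Metric.measure_ball_pos _ _ (by positivity)).ne'
  have hbt : b ≠ ⊤ := measure_ball_lt_top.ne
  have hvol : ∀ ν : EuclideanSpace ℝ (Fin d), volume (Metric.ball ν (δ / 2)) = b := fun ν =>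
    Measure.addHaar_ball_center _ _ _
  rw [← ENNReal.mul_le_iff_le_inv hb0 hbt, Finset.mul_sum]
  have hdisj : Set.PairwiseDisjoint (s : Set ι)
      fun ν => Metric.ball (y ν) (δ / 2) := by
    intro ν _ μ _ hne
    refine Metric.ball_disjoint_ball ?_
    have := hy hne
    linarith
  calc ∑ ν ∈ s, b * expWeight (z - y ν)
      ≤ ∑ ν ∈ s, ∫⁻ w in Metric.ball (y ν) (δ / 2),
          ENNReal.ofReal (Real.exp (δ / 2)) * expWeight (z - w) := by
        refine Finset.sum_le_sum fun ν _ => ?_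
        rw [← hvol (y ν), mul_comm, ← setLIntegral_const]
        refine setLIntegral_mono' measurableSet_ball fun w hw => ?_
        refine (expWeight_le (z - y ν) (z - w)).trans ?_
        gcongr
        rw [sub_sub_sub_cancel_left, ← dist_eq_norm]
        exact (Metric.mem_ball.1 hw).le
    _ = ∫⁻ w in ⋃ ν ∈ s, Metric.ball (y ν) (δ / 2),
          ENNReal.ofReal (Real.exp (δ / 2)) * expWeight (z - w) :=
        (lintegral_biUnion_finset hdisj (fun _ _ => measurableSet_ball) _).symm
    _ ≤ ∫⁻ w, ENNReal.ofReal (Real.exp (δ / 2)) * expWeight (z - w) := setLIntegral_le_lintegral _ _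
    _ = _ := by
        rw [lintegral_const_mul' _ _ ENNReal.ofReal_ne_top, lintegral_sub_left_eq_self expWeight z]

/-- The values of the Fourier transform on a uniformly separated set are square summable, with a
bound by a Sobolev norm of order larger than `d / 2`. -/
theorem exists_sum_enorm_fourier_sq_le {m : ℕ} [NeZero d] (hm : d < 2 * m)
    {ι : Type*} {y : ι → EuclideanSpace ℝ (Fin d)} {δ : ℝ} (hδ : 0 < δ)
    (hy : Pairwise fun i j => δ ≤ dist (y i) (y j)) :
    ∃ B : ℝ≥0∞, B < ⊤ ∧ ∀ u : EuclideanSpace ℝ (Fin d) → ℂ, AEStronglyMeasurable u →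
      sobolevNormSq m u < ⊤ → ∀ s : Finset ι,
        ∑ ν ∈ s, ‖𝓕 u (y ν)‖ₑ ^ 2 ≤ B * sobolevNormSq m u := by
  obtain ⟨G, C, -, hG1, hG2, hC⟩ := exists_besselKernel (d := d) hm
  set S : ℝ≥0∞ := (volume (Metric.ball (0 : EuclideanSpace ℝ (Fin d)) (δ / 2)))⁻¹ *
        (ENNReal.ofReal (Real.exp (δ / 2)) *
          ∫⁻ w : EuclideanSpace ℝ (Fin d), expWeight w) with hS
  set D : ℝ≥0∞ := ∫⁻ z : EuclideanSpace ℝ (Fin d), ‖Real.exp (‖z‖ / 2) * G z‖ₑ ^ 2 with hD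
  have hStop : S < ⊤ := ENNReal.mul_lt_top
    (ENNReal.inv_lt_top.2 (Metric.measure_ball_pos _ _ (by positivity)))
    (ENNReal.mul_lt_top ENNReal.ofReal_lt_top lintegral_expWeight_lt_top)
  have hDtop : D < ⊤ := by
    rw [hD, lintegral_enorm_sq_eq_eLpNorm_sq]
    exact ENNReal.pow_lt_top hG2.2
  refine ⟨D * S * ENNReal.ofReal C,
    ENNReal.mul_lt_top (ENNReal.mul_lt_top hDtop hStop) ENNReal.ofReal_lt_top,
    fun u hu hN s => ?_⟩
  obtain ⟨Γ, hΓ, hΓN, hΓu⟩ := exists_fourier_eq_integral_kernel hG1 hG2 hC hu hN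
  have hmeas : ∀ ν : ι, AEMeasurable fun z =>
      expWeight (z - y ν) * ‖Γ z‖ₑ ^ 2 := fun ν =>
    ((measurable_expWeight.comp (measurable_sub_const _)).aemeasurable).mul
      (hΓ.1.enorm.pow_const 2)
  calc ∑ ν ∈ s, ‖𝓕 u (y ν)‖ₑ ^ 2
      ≤ ∑ ν ∈ s, D * ∫⁻ z, expWeight (z - y ν) * ‖Γ z‖ₑ ^ 2 := by
        refine Finset.sum_le_sum fun ν _ => ?_
        rw [hΓu]
        exact enorm_integral_translate_mul_sq_le hG1.1 hΓ.1 _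
    _ = D * ∫⁻ z, (∑ ν ∈ s, expWeight (z - y ν)) * ‖Γ z‖ₑ ^ 2 := by
        rw [← Finset.mul_sum, ← lintegral_finsetSum' _ fun ν _ => hmeas ν]
        simp_rw [Finset.sum_mul]
    _ ≤ D * ∫⁻ z, S * ‖Γ z‖ₑ ^ 2 := by
        gcongr with z
        exact sum_expWeight_le hδ hy s z
    _ = D * S * ∫⁻ z, ‖Γ z‖ₑ ^ 2 := by
        rw [lintegral_const_mul' _ _ hStop.ne, ← mul_assoc]
    _ ≤ D * S * (ENNReal.ofReal C * sobolevNormSq m u) := by gcongr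
    _ = _ := by rw [← mul_assoc]

theorem one_add_pow_le_two_pow_mul {t : ℝ} (ht : 0 ≤ t) (m : ℕ) :
    (1 + t) ^ m ≤ 2 ^ m * (1 + t ^ m) := by
  rcases le_total t 1 with h | h
  · have : (1 + t) ^ m ≤ 2 ^ m := pow_le_pow_left₀ (by linarith) (by linarith) m
    nlinarith [pow_nonneg ht m, pow_pos (two_pos (α := ℝ)) m]
  · have : (1 + t) ^ m ≤ (2 * t) ^ m := pow_le_pow_left₀ (by linarith) (by linarith) m
    rw [mul_pow] at this
    nlinarith [pow_nonneg ht m, pow_pos (two_pos (α := ℝ)) m]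

theorem sobolevNormSq_le_add (m : ℕ) {u : EuclideanSpace ℝ (Fin d) → ℂ}
    (hu : AEStronglyMeasurable u) :
    sobolevNormSq m u ≤ 2 ^ m * ((∫⁻ x, ‖u x‖ₑ ^ 2) +
      ∫⁻ x, ENNReal.ofReal (‖x‖ ^ (2 * m)) * ‖u x‖ₑ ^ 2) := by
  rw [← lintegral_add_left' (hu.enorm.pow_const 2), ← lintegral_const_mul' _ _ (by finiteness),
    sobolevNormSq]
  refine lintegral_mono fun x => ?_
  rw [← one_add_mul, ← mul_assoc]
  gcongr
  have h2 : (2 : ℝ≥0∞) ^ m = ENNReal.ofReal (2 ^ m) := by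
    rw [ENNReal.ofReal_pow two_pos.le, ENNReal.ofReal_ofNat]
  rw [h2, ← ENNReal.ofReal_one, ← ENNReal.ofReal_add one_pos.le (by positivity),
    ← ENNReal.ofReal_mul (by positivity)]
  refine ENNReal.ofReal_le_ofReal ?_
  rw [pow_mul]
  exact one_add_pow_le_two_pow_mul (sq_nonneg _) m

/-- Sampling inequality at a fixed scale: if the Fourier transform of `u` vanishes on a set that is
dense at a small scale `δ = δ(d, m)`, then `‖u‖ ≤ ‖|x| ^ m u‖`. The oscillation of `𝓕 u` over
distances `δ` is, by continuity of translations, a small multiple of the full Sobolev norm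
`‖u‖ + ‖|x| ^ m u‖`, and the first term is absorbed. -/
theorem exists_lintegral_sq_le_of_fourier_eq_zero {m : ℕ} [NeZero d] (hm : d < 2 * m) :
    ∃ δ : ℝ, 0 < δ ∧ ∀ Ξ : Set (EuclideanSpace ℝ (Fin d)), (∀ x, ∃ ξ ∈ Ξ, dist x ξ ≤ δ) →
      ∀ u : EuclideanSpace ℝ (Fin d) → ℂ, AEStronglyMeasurable u → sobolevNormSq m u < ⊤ →
        (∀ ξ ∈ Ξ, 𝓕 u ξ = 0) →
        ∫⁻ x, ‖u x‖ₑ ^ 2 ≤ ∫⁻ x, ENNReal.ofReal (‖x‖ ^ (2 * m)) * ‖u x‖ₑ ^ 2 := by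
  obtain ⟨G, C, hC0, hG1, hG2, hC⟩ := exists_besselKernel (d := d) hm
  set W : ℝ≥0∞ := ∫⁻ z : EuclideanSpace ℝ (Fin d), expWeight z with hW
  have hWtop : W < ⊤ := lintegral_expWeight_lt_top
  -- With `kernelModulus G ≤ M⁻¹` the oscillation is at most half of `‖u‖² + ‖|x| ^ m u‖²`.
  set M : ℝ≥0∞ := W * (ENNReal.ofReal C * (2 ^ m * 2)) + 1 with hM
  have hMtop : M ≠ ⊤ := by
    have := hWtop.ne
    rw [hM]
    finiteness
  have hM0 : M ≠ 0 := by simp [hM]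
  have hev : ∀ᶠ h in 𝓝 (0 : EuclideanSpace ℝ (Fin d)), kernelModulus G h < M⁻¹ :=
    (tendsto_kernelModulus hG2).eventually_lt_const (ENNReal.inv_pos.2 hMtop)
  obtain ⟨ρ, hρ, hball⟩ := Metric.eventually_nhds_iff.1 hev
  refine ⟨ρ / 2, by positivity, fun Ξ hΞ u hu hN hzero => ?_⟩
  have hi : Integrable u := integrable_of_sobolevNormSq_lt_top hm hu hN
  have hL : MemLp u 2 := memLp_of_sobolevNormSq_lt_top hu hN
  obtain ⟨Γ, hΓ, hΓN, hΓu⟩ := exists_fourier_eq_integral_kernel hG1 hG2 hC hu hN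
  have hG2' : MemLp (fun z => (G z : ℂ)) 2 := by
    refine (hG2.of_le hG1.1 (ae_of_all _ fun z => ?_)).ofReal
    rw [norm_mul, Real.norm_of_nonneg (Real.exp_nonneg _)]
    exact le_mul_of_one_le_left (norm_nonneg _) (Real.one_le_exp (by positivity))
  have hGΓ : ∀ η, Integrable fun z => (G (z - η) : ℂ) * Γ z := fun η =>
    (hG2'.comp_measurePreserving (measurePreserving_sub_right volume η)).integrable_mul hΓ
  have hpt : ∀ η, ‖𝓕 u η‖ₑ ^ 2 ≤ M⁻¹ * ∫⁻ z, expWeight (z - η) * ‖Γ z‖ₑ ^ 2 := by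
    intro η
    -- Subtract the value `0` of `𝓕 u` at a point `ξ` of `Ξ` close to `η`.
    obtain ⟨ξ, hξ, hdist⟩ := hΞ η
    have e : 𝓕 u η = ∫ z, ((G (z - η) - G (z - η - (ξ - η)) : ℝ) : ℂ) * Γ z := by
      rw [← sub_zero (𝓕 u η), ← hzero ξ hξ, hΓu, hΓu, ← integral_sub (hGΓ η) (hGΓ ξ)]
      refine integral_congr_ae (ae_of_all _ fun z => ?_)
      simp only [sub_sub_sub_cancel_right, Complex.ofReal_sub]
      ring
    rw [e]
    have hK : AEStronglyMeasurable fun z => G z - G (z - (ξ - η)) :=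
      hG1.1.sub (hG1.1.comp_measurePreserving (measurePreserving_sub_right volume (ξ - η)))
    refine (enorm_integral_translate_mul_sq_le hK hΓ.1 η).trans ?_
    gcongr
    refine (hball (y := ξ - η) ?_).le
    rw [dist_zero_right, ← dist_eq_norm, dist_comm]
    linarith
  have hmain : ∫⁻ x, ‖u x‖ₑ ^ 2 ≤ M⁻¹ * (W * (ENNReal.ofReal C * sobolevNormSq m u)) := by
    have hm2 : AEMeasurable (Function.uncurry fun η z : EuclideanSpace ℝ (Fin d) =>
        expWeight (z - η) * ‖Γ z‖ₑ ^ 2) (volume.prod volume) := by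
      refine AEMeasurable.mul (measurable_expWeight.comp (by fun_prop)).aemeasurable ?_
      exact ((hΓ.1.comp_snd).enorm.pow_const 2)
    calc ∫⁻ x, ‖u x‖ₑ ^ 2 = ∫⁻ η, ‖𝓕 u η‖ₑ ^ 2 := (lintegral_enorm_fourier_sq hi hL).symm
      _ ≤ ∫⁻ η, M⁻¹ * ∫⁻ z, expWeight (z - η) * ‖Γ z‖ₑ ^ 2 := lintegral_mono hpt
      _ = M⁻¹ * ∫⁻ η, ∫⁻ z, expWeight (z - η) * ‖Γ z‖ₑ ^ 2 :=
          lintegral_const_mul' _ _ (ENNReal.inv_ne_top.2 hM0)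
      _ = M⁻¹ * ∫⁻ z, ∫⁻ η, expWeight (z - η) * ‖Γ z‖ₑ ^ 2 := by
          rw [lintegral_lintegral_swap hm2]
      _ = M⁻¹ * ∫⁻ z, W * ‖Γ z‖ₑ ^ 2 := by
          congr 1
          refine lintegral_congr fun z => ?_
          rw [lintegral_mul_const' _ _ (by finiteness), lintegral_sub_left_eq_self expWeight z]
      _ = M⁻¹ * (W * ∫⁻ z, ‖Γ z‖ₑ ^ 2) := by rw [lintegral_const_mul' _ _ hWtop.ne]
      _ ≤ _ := by gcongr
  set A := ∫⁻ x, ‖u x‖ₑ ^ 2 with hA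
  set B := ∫⁻ x, ENNReal.ofReal (‖x‖ ^ (2 * m)) * ‖u x‖ₑ ^ 2 with hB
  have hAtop : A ≠ ⊤ := ((lintegral_enorm_sq_le_sobolevNormSq m u).trans_lt hN).ne
  have h2A : 2 * A ≤ A + B := by
    calc 2 * A ≤ 2 * (M⁻¹ * (W * (ENNReal.ofReal C * (2 ^ m * (A + B))))) := by
          gcongr
          refine hmain.trans ?_
          gcongr
          exact sobolevNormSq_le_add m hu
      _ = M⁻¹ * (W * (ENNReal.ofReal C * (2 ^ m * 2))) * (A + B) := by ring
      _ ≤ M⁻¹ * M * (A + B) := by gcongr; exact le_self_add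
      _ = A + B := by rw [ENNReal.inv_mul_cancel hM0 hMtop, one_mul]
  rw [two_mul] at h2A
  exact (ENNReal.add_le_add_iff_left hAtop).1 h2A

/-! ### The sampling inequality of arbitrary order -/

/-- Young's inequality `t ^ m ≤ (1 - m / k) + (m / k) t ^ k`, multiplied by `k`. -/
theorem mul_pow_le_sub_add_mul_pow {t : ℝ} (ht : 0 ≤ t) {m k : ℕ} (hm : 0 < m) (hmk : m ≤ k) :
    k * t ^ m ≤ (k - m : ℕ) + m * t ^ k := by
  have hk : (0 : ℝ) < k := by exact_mod_cast hm.trans_le hmk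
  have h := Real.geom_mean_le_arith_mean2_weighted (w₁ := (k - m : ℕ) / k) (w₂ := m / k)
    (p₁ := 1) (p₂ := t ^ k) (by positivity) (by positivity) zero_le_one (by positivity)
    (by rw [Nat.cast_sub hmk]; field_simp; ring)
  rw [Real.one_rpow, one_mul, ← Real.rpow_natCast t k, ← Real.rpow_mul ht,
    mul_div_cancel₀ _ hk.ne', Real.rpow_natCast, Real.rpow_natCast] at h
  calc (k : ℝ) * t ^ m ≤ k * ((k - m : ℕ) / k * 1 + m / k * t ^ k) := by gcongr
    _ = _ := by field_simp

/-- Interpolation between the orders `0` and `k`: an inequality `‖u‖ ≤ ‖|x| ^ m u‖` persists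
when `m` is increased. -/
theorem lintegral_sq_le_of_le {m k : ℕ} (hm : 0 < m) (hmk : m ≤ k)
    {u : EuclideanSpace ℝ (Fin d) → ℂ} (hu : AEStronglyMeasurable u)
    (hL : ∫⁻ x, ‖u x‖ₑ ^ 2 ≠ ⊤)
    (h : ∫⁻ x, ‖u x‖ₑ ^ 2 ≤ ∫⁻ x, ENNReal.ofReal (‖x‖ ^ (2 * m)) * ‖u x‖ₑ ^ 2) :
    ∫⁻ x, ‖u x‖ₑ ^ 2 ≤ ∫⁻ x, ENNReal.ofReal (‖x‖ ^ (2 * k)) * ‖u x‖ₑ ^ 2 := by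
  set A := ∫⁻ x, ‖u x‖ₑ ^ 2 with hA
  have hpt : ∀ x, (k : ℝ≥0∞) * (ENNReal.ofReal (‖x‖ ^ (2 * m)) * ‖u x‖ₑ ^ 2) ≤
      (k - m : ℕ) * ‖u x‖ₑ ^ 2 + m * (ENNReal.ofReal (‖x‖ ^ (2 * k)) * ‖u x‖ₑ ^ 2) := by
    intro x
    rw [← mul_assoc, ← mul_assoc, ← add_mul]
    gcongr
    rw [← ENNReal.ofReal_natCast, ← ENNReal.ofReal_natCast, ← ENNReal.ofReal_natCast,
      ← ENNReal.ofReal_mul (by positivity), ← ENNReal.ofReal_mul (by positivity),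
      ← ENNReal.ofReal_add (by positivity) (by positivity), pow_mul, pow_mul]
    exact ENNReal.ofReal_le_ofReal (mul_pow_le_sub_add_mul_pow (sq_nonneg _) hm hmk)
  have h1 : (k : ℝ≥0∞) * A ≤ (k - m : ℕ) * A +
      m * ∫⁻ x, ENNReal.ofReal (‖x‖ ^ (2 * k)) * ‖u x‖ₑ ^ 2 := by
    calc (k : ℝ≥0∞) * A ≤ k * ∫⁻ x, ENNReal.ofReal (‖x‖ ^ (2 * m)) * ‖u x‖ₑ ^ 2 := by gcongr
      _ = ∫⁻ x, (k : ℝ≥0∞) * (ENNReal.ofReal (‖x‖ ^ (2 * m)) * ‖u x‖ₑ ^ 2) :=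
          (lintegral_const_mul' _ _ (by finiteness)).symm
      _ ≤ _ := lintegral_mono hpt
      _ = _ := by
          rw [lintegral_add_left' ((hu.enorm.pow_const 2).const_mul _),
            lintegral_const_mul' _ _ (by finiteness), lintegral_const_mul' _ _ (by finiteness)]
  have h2 : (k : ℝ≥0∞) * A = (k - m : ℕ) * A + m * A := by
    rw [← add_mul, ← Nat.cast_add, Nat.sub_add_cancel hmk]
  rw [h2] at h1
  have h3 := (ENNReal.add_le_add_iff_left (by finiteness)).1 h1
  exact (ENNReal.mul_le_mul_iff_right (by exact_mod_cast hm.ne') (by finiteness)).1 h3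

theorem lintegral_comp_smul_eq {ρ : ℝ} (hρ : 0 < ρ) (f : EuclideanSpace ℝ (Fin d) → ℝ≥0∞) :
    ∫⁻ x, f (ρ⁻¹ • x) = ENNReal.ofReal (ρ ^ d) * ∫⁻ x, f x := by
  have hρ' : ρ⁻¹ ≠ 0 := inv_ne_zero hρ.ne'
  have h := lintegral_map_equiv (μ := (volume : Measure (EuclideanSpace ℝ (Fin d)))) f
    (Homeomorph.smulOfNeZero ρ⁻¹ hρ').toMeasurableEquiv
  have h2 := Measure.map_addHaar_smul (volume : Measure (EuclideanSpace ℝ (Fin d))) hρ'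
  rw [finrank_euclideanSpace_fin] at h2
  have h3 : Measure.map (Homeomorph.smulOfNeZero ρ⁻¹ hρ').toMeasurableEquiv
      (volume : Measure (EuclideanSpace ℝ (Fin d))) = ENNReal.ofReal (ρ ^ d) • volume := by
    rw [inv_pow, inv_inv, abs_of_pos (by positivity)] at h2
    exact h2
  rw [h3, lintegral_smul_measure] at h
  exact h.symm

theorem fourier_comp_smul_eq {ρ : ℝ} (hρ : 0 < ρ) (u : EuclideanSpace ℝ (Fin d) → ℂ)
    (ξ : EuclideanSpace ℝ (Fin d)) :
    𝓕 (fun x => u (ρ⁻¹ • x)) (ρ⁻¹ • ξ) = ((ρ ^ d : ℝ) : ℂ) * 𝓕 u ξ := by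
  rw [Real.fourier_eq', Real.fourier_eq']
  have h := Measure.integral_comp_smul (volume : Measure (EuclideanSpace ℝ (Fin d)))
    (fun y => Complex.exp (((-2 * Real.pi * ⟪y, ξ⟫ : ℝ) : ℂ) * Complex.I) • u y) ρ⁻¹
  rw [finrank_euclideanSpace_fin, inv_pow, inv_inv, abs_of_pos (by positivity),
    Complex.real_smul] at h
  rw [← h]
  refine integral_congr_ae (ae_of_all _ fun x => ?_)
  simp only [inner_smul_left, inner_smul_right]
  simp

/-- Sampling inequality: if the Fourier transform of `u` vanishes on a set meeting every closed ball
of radius `lam`, then `‖u‖ ≤ (C lam) ^ k ‖|x| ^ k u‖` for every `k ≥ m > d / 2`, with `C` depending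
on `d` and `m` only. -/
theorem exists_sampling_inequality {m : ℕ} [NeZero d] (hm : d < 2 * m) :
    ∃ C : ℝ, 0 < C ∧ ∀ (lam : ℝ) (Ξ : Set (EuclideanSpace ℝ (Fin d))), 0 < lam →
      (∀ x, ∃ ξ ∈ Ξ, dist x ξ ≤ lam) → ∀ k, m ≤ k →
      ∀ u : EuclideanSpace ℝ (Fin d) → ℂ, AEStronglyMeasurable u → sobolevNormSq k u < ⊤ →
        (∀ ξ ∈ Ξ, 𝓕 u ξ = 0) →
        ∫⁻ x, ‖u x‖ₑ ^ 2 ≤ ENNReal.ofReal ((C * lam) ^ (2 * k)) *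
          ∫⁻ x, ENNReal.ofReal (‖x‖ ^ (2 * k)) * ‖u x‖ₑ ^ 2 := by
  obtain ⟨δ, hδ, H⟩ := exists_lintegral_sq_le_of_fourier_eq_zero hm
  refine ⟨δ⁻¹, by positivity, fun lam Ξ hlam hΞ k hmk u hu hN hzero => ?_⟩
  obtain ⟨ρ, hρdef⟩ : ∃ ρ, ρ = δ⁻¹ * lam := ⟨_, rfl⟩
  have hρ : 0 < ρ := by rw [hρdef]; positivity
  rw [← hρdef]
  -- The Fourier transform of the dilate `v` vanishes on `ρ⁻¹ Ξ`, which is dense at the scale `δ`.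
  set v : EuclideanSpace ℝ (Fin d) → ℂ := fun x => u (ρ⁻¹ • x) with hv
  have hvm : AEStronglyMeasurable v :=
    hu.comp_quasiMeasurePreserving ⟨by fun_prop, by
      rw [Measure.map_addHaar_smul _ (inv_ne_zero hρ.ne')]
      exact Measure.smul_absolutelyContinuous⟩
  have hv0 : ∫⁻ x, ‖v x‖ₑ ^ 2 = ENNReal.ofReal (ρ ^ d) * ∫⁻ x, ‖u x‖ₑ ^ 2 :=
    lintegral_comp_smul_eq hρ fun x => ‖u x‖ₑ ^ 2
  have hvk : ∀ j : ℕ, ∫⁻ x, ENNReal.ofReal (‖x‖ ^ (2 * j)) * ‖v x‖ₑ ^ 2 =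
      ENNReal.ofReal (ρ ^ d) * (ENNReal.ofReal (ρ ^ (2 * j)) *
        ∫⁻ x, ENNReal.ofReal (‖x‖ ^ (2 * j)) * ‖u x‖ₑ ^ 2) := by
    intro j
    rw [← lintegral_const_mul' _ _ ENNReal.ofReal_ne_top, ← lintegral_comp_smul_eq hρ]
    refine lintegral_congr fun x => ?_
    rw [← mul_assoc, ← ENNReal.ofReal_mul (by positivity), norm_smul, norm_inv,
      Real.norm_of_nonneg hρ.le, ← mul_pow, mul_inv_cancel_left₀ hρ.ne']
  have hpow : ∀ j, j ≤ k → ∀ x : EuclideanSpace ℝ (Fin d),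
      ‖x‖ ^ (2 * j) ≤ (1 + ‖x‖ ^ 2) ^ k := by
    intro j hj x
    rw [pow_mul]
    calc (‖x‖ ^ 2) ^ j ≤ (1 + ‖x‖ ^ 2) ^ j := by gcongr; linarith
      _ ≤ _ := pow_le_pow_right₀ (by nlinarith [sq_nonneg ‖x‖]) hj
  have hu0 : ∫⁻ x, ‖u x‖ₑ ^ 2 < ⊤ := (lintegral_enorm_sq_le_sobolevNormSq k u).trans_lt hN
  have hvtop : ∫⁻ x, ‖v x‖ₑ ^ 2 ≠ ⊤ := by
    rw [hv0]; exact ENNReal.mul_ne_top ENNReal.ofReal_ne_top hu0.ne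
  have hvN : sobolevNormSq m v < ⊤ := by
    refine (sobolevNormSq_le_add m hvm).trans_lt
      (ENNReal.mul_lt_top (by finiteness) (ENNReal.add_lt_top.2 ⟨hvtop.lt_top, ?_⟩))
    rw [hvk]
    refine ENNReal.mul_lt_top ENNReal.ofReal_lt_top (ENNReal.mul_lt_top ENNReal.ofReal_lt_top ?_)
    refine lt_of_le_of_lt (lintegral_mono fun x => ?_) hN
    gcongr
    exact hpow m hmk x
  have hΞ' : ∀ x, ∃ ξ ∈ (fun ξ => ρ⁻¹ • ξ) '' Ξ, dist x ξ ≤ δ := by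
    intro x
    obtain ⟨ξ, hξ, hd⟩ := hΞ (ρ • x)
    refine ⟨ρ⁻¹ • ξ, ⟨ξ, hξ, rfl⟩, ?_⟩
    have : x = ρ⁻¹ • (ρ • x) := by rw [smul_smul, inv_mul_cancel₀ hρ.ne', one_smul]
    rw [this, dist_smul₀, norm_inv, Real.norm_of_nonneg hρ.le]
    calc ρ⁻¹ * dist (ρ • x) ξ ≤ ρ⁻¹ * lam := by gcongr
      _ = δ := by rw [hρdef]; field_simp
  have hvz : ∀ ξ ∈ (fun ξ => ρ⁻¹ • ξ) '' Ξ, 𝓕 v ξ = 0 := by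
    rintro _ ⟨ξ, hξ, rfl⟩
    simp only
    rw [hv, fourier_comp_smul_eq hρ, hzero ξ hξ, mul_zero]
  have hm0 : 0 < m := by omega
  have hfin := lintegral_sq_le_of_le hm0 hmk hvm hvtop (H _ hΞ' v hvm hvN hvz)
  rw [hv0, hvk] at hfin
  exact (ENNReal.mul_le_mul_iff_right (by simpa using by positivity) ENNReal.ofReal_ne_top).1 hfin

end Sampling

/-! ### Biorthogonal Bessel families in a Hilbert space -/

section Biorthogonal

variable {ι H : Type*} [NormedAddCommGroup H] [InnerProductSpace ℂ H]

/-- A family `v` of vectors is a Bessel family if `∑ |⟪v i, F⟫|² ≤ B ‖F‖²` for some `B`. -/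
def IsBesselFamily (v : ι → H) : Prop :=
  ∃ B : ℝ, ∀ (F : H) (s : Finset ι), ∑ i ∈ s, ‖inner ℂ (v i) F‖ ^ 2 ≤ B * ‖F‖ ^ 2

theorem IsBesselFamily.exists_analysis {v : ι → H} (hv : IsBesselFamily v) :
    ∃ A : H →L[ℂ] lp (fun _ : ι => ℂ) 2, ∀ F i, A F i = inner ℂ (v i) F := by
  obtain ⟨B, hB⟩ := hv
  have hB' : ∀ (F : H) (s : Finset ι),
      ∑ i ∈ s, ‖inner ℂ (v i) F‖ ^ (2 : ℝ≥0∞).toReal ≤ |B| * ‖F‖ ^ 2 := by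
    intro F s
    simp only [ENNReal.toReal_ofNat, Real.rpow_ofNat]
    refine (hB F s).trans ?_
    gcongr
    exact le_abs_self B
  let A₀ : H →ₗ[ℂ] lp (fun _ : ι => ℂ) 2 :=
    { toFun := fun F => ⟨fun i => inner ℂ (v i) F, memℓp_gen' (hB' F)⟩
      map_add' := fun F G => by ext i; exact inner_add_right _ _ _
      map_smul' := fun c F => by ext i; exact inner_smul_right _ _ _ }
  refine ⟨A₀.mkContinuous (Real.sqrt |B|) fun F => ?_, fun F i => rfl⟩
  refine lp.norm_le_of_forall_sum_le (by simp) (by positivity) fun s => ?_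
  refine (hB' F s).trans_eq ?_
  simp only [ENNReal.toReal_ofNat, Real.rpow_ofNat]
  rw [mul_pow, Real.sq_sqrt (abs_nonneg B)]

variable [CompleteSpace H]

theorem IsBesselFamily.exists_synthesis [DecidableEq ι] {v : ι → H} (hv : IsBesselFamily v) :
    ∃ T : lp (fun _ : ι => ℂ) 2 →L[ℂ] H, (∀ i, T (lp.single 2 i 1) = v i) ∧
      ∀ F i, (ContinuousLinearMap.adjoint T) F i = inner ℂ (v i) F := by
  obtain ⟨A, hA⟩ := hv.exists_analysis
  refine ⟨ContinuousLinearMap.adjoint A, fun i => ?_, fun F i => ?_⟩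
  · refine ext_inner_right ℂ fun F => ?_
    rw [ContinuousLinearMap.adjoint_inner_left, lp.inner_single_left, hA]
    simp
  · rw [ContinuousLinearMap.adjoint_adjoint, hA]

/-- Let `v` and `p` be biorthogonal Bessel families. Then `v` is a Riesz sequence: with `T` the
synthesis operator of `v` and `P` the orthogonal projection onto its (closed) range, the vectors
`P (p ν) = T (a ν)` are biorthogonal to `v`, and `P F = ∑ ⟪v ν, F⟫ P (p ν)`. -/
theorem exists_biorthogonal_expansion [DecidableEq ι] {v p : ι → H} (hv : IsBesselFamily v)
    (hp : IsBesselFamily p) (hvp : ∀ μ ν, inner ℂ (v μ) (p ν) = if μ = ν then 1 else 0) :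
    ∃ (T : lp (fun _ : ι => ℂ) 2 →L[ℂ] H) (a : ι → lp (fun _ : ι => ℂ) 2) (P : H →L[ℂ] H),
      (∀ b : lp (fun _ : ι => ℂ) 2, HasSum (fun ν => b ν • v ν) (T b)) ∧
      (∀ μ ν, inner ℂ (v μ) (T (a ν)) = if μ = ν then 1 else 0) ∧
      (∀ b, (∀ μ, inner ℂ (v μ) (T b) = 0) → b = 0) ∧
      (∀ F, HasSum (fun ν => inner ℂ (v ν) F • T (a ν)) (P F)) ∧
      (∀ F μ, inner ℂ (v μ) (F - P F) = 0) ∧ ∀ F, inner ℂ (F - P F) (P F) = 0 := by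
  obtain ⟨T, hT1, hT2⟩ := hv.exists_synthesis
  obtain ⟨S, hS1, hS2⟩ := hp.exists_synthesis
  have hsingle : ∀ (R : lp (fun _ : ι => ℂ) 2 →L[ℂ] H) (b : lp (fun _ : ι => ℂ) 2),
      HasSum (fun ν => b ν • R (lp.single 2 ν 1)) (R b) := by
    intro R b
    have h := (lp.hasSum_single (by simp) b).mapL R
    refine h.congr_fun fun ν => ?_
    rw [← map_smul, ← lp.single_smul, smul_eq_mul, mul_one]
  -- The analysis operator of `v` inverts the synthesis operator of `p`, and conversely.
  have hAS : ∀ b, ContinuousLinearMap.adjoint T (S b) = b := by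
    have : (ContinuousLinearMap.adjoint T).comp S = ContinuousLinearMap.id ℂ _ := by
      refine lp.ext_continuousLinearMap (by simp) fun ν => ?_
      ext
      simp [hS1, hT2, hvp, Pi.single_apply]
    intro b
    exact congrArg (fun R => R b) this
  have hST : ∀ b, ContinuousLinearMap.adjoint S (T b) = b := by
    intro b
    refine ext_inner_right ℂ fun c => ?_
    rw [ContinuousLinearMap.adjoint_inner_left, ← ContinuousLinearMap.adjoint_inner_right, hAS]
  have hclosed : IsClosed (LinearMap.range T.toLinearMap : Set H) := by
    have : IsClosedEmbedding T :=
      Function.LeftInverse.isClosedEmbedding hST (ContinuousLinearMap.adjoint S).continuous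
        T.continuous
    rw [LinearMap.coe_range]
    exact this.isClosed_range
  set K : Submodule ℂ H := LinearMap.range T.toLinearMap with hK
  have : CompleteSpace K := hclosed.completeSpace_coe
  set P : H →L[ℂ] H := K.starProjection with hP
  have hmem : ∀ F, ∃ b, T b = P F := fun F => by
    have : P F ∈ K := K.starProjection_apply_mem F
    simpa [hK] using this
  have hperp : ∀ F, F - P F ∈ Kᗮ := fun F => K.sub_starProjection_mem_orthogonal F
  have hv_mem : ∀ μ, v μ ∈ K := fun μ => ⟨lp.single 2 μ 1, hT1 μ⟩
  have hvP : ∀ F μ, inner ℂ (v μ) (F - P F) = 0 := fun F μ =>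
    (Submodule.mem_orthogonal K _).1 (hperp F) _ (hv_mem μ)
  choose a ha using fun ν => hmem (p ν)
  have hA : ∀ F, (∀ μ, inner ℂ (v μ) F = 0) → ContinuousLinearMap.adjoint T F = 0 := by
    intro F hF
    ext μ
    rw [hT2, hF]
    rfl
  refine ⟨T, a, P, fun b => ?_, fun μ ν => ?_, fun b hb => ?_, fun F => ?_, hvP, fun F => ?_⟩
  · simpa only [hT1] using hsingle T b
  · have h := hvP (p ν) μ
    rw [inner_sub_right, sub_eq_zero, hvp] at h
    rw [ha, ← h]
  · have h0 : ContinuousLinearMap.adjoint T (T b) = 0 := hA _ hb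
    have h1 : T b = 0 := by
      rw [← inner_self_eq_zero (𝕜 := ℂ), ← ContinuousLinearMap.adjoint_inner_right, h0,
        inner_zero_right]
    rw [← hST b, h1, map_zero]
  · have h := (hsingle S (ContinuousLinearMap.adjoint T F)).mapL P
    have hPF : P (S (ContinuousLinearMap.adjoint T F)) = P F := by
      rw [← sub_eq_zero, ← map_sub]
      refine (Submodule.starProjection_apply_eq_zero_iff K).2 ?_
      rw [Submodule.mem_orthogonal]
      rintro _ ⟨b, rfl⟩
      rw [ContinuousLinearMap.coe_coe, ← ContinuousLinearMap.adjoint_inner_right, map_sub, hAS,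
        sub_self, inner_zero_right]
    rw [hPF] at h
    refine h.congr_fun fun ν => ?_
    rw [map_smul, hS1, hT2, ha]
  · exact (Submodule.mem_orthogonal' K _).1 (hperp F) _ (K.starProjection_apply_mem F)

end Biorthogonal

/-! ### Modulations and multiplication operators -/

section Modulation

open scoped ComplexConjugate

variable {d : ℕ}

theorem ae_comp_smul {c : ℝ} (hc : c ≠ 0) {p : EuclideanSpace ℝ (Fin d) → Prop}
    (h : ∀ᵐ x, p x) : ∀ᵐ x, p (c • x) := by
  have hq : Measure.QuasiMeasurePreserving (fun x : EuclideanSpace ℝ (Fin d) => c • x) :=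
    ⟨by fun_prop, by
      rw [Measure.map_addHaar_smul _ hc]
      exact Measure.smul_absolutelyContinuous⟩
  exact hq.ae h

theorem memLp_cexp_mul {q : EuclideanSpace ℝ (Fin d) → ℂ} (hq : MemLp q 2)
    (ξ : EuclideanSpace ℝ (Fin d)) :
    MemLp (fun x => Complex.exp (Complex.I * (⟪ξ, x⟫ : ℝ)) * q x) 2 := by
  have hm : Measurable fun x : EuclideanSpace ℝ (Fin d) =>
      Complex.exp (Complex.I * (⟪ξ, x⟫ : ℝ)) := by fun_prop
  refine hq.of_le (hm.aestronglyMeasurable.mul hq.1) (ae_of_all _ fun x => ?_)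
  rw [norm_mul, mul_comm Complex.I, Complex.norm_exp_ofReal_mul_I, one_mul]

/-- The modulation `e ^ (i ξ·x) q(x)` of an `L²` function. -/
noncomputable def modulation {q : EuclideanSpace ℝ (Fin d) → ℂ} (hq : MemLp q 2)
    (ξ : EuclideanSpace ℝ (Fin d)) : Lp ℂ 2 (volume : Measure (EuclideanSpace ℝ (Fin d))) :=
  (memLp_cexp_mul hq ξ).toLp _

theorem inner_modulation {q : EuclideanSpace ℝ (Fin d) → ℂ} (hq : MemLp q 2)
    (ξ : EuclideanSpace ℝ (Fin d)) (F : Lp ℂ 2 (volume : Measure (EuclideanSpace ℝ (Fin d)))) :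
    inner ℂ (modulation hq ξ) F = 𝓕 (fun x => conj (q x) * F x) ((2 * Real.pi)⁻¹ • ξ) := by
  rw [L2.inner_def, Real.fourier_eq']
  refine integral_congr_ae ?_
  filter_upwards [(memLp_cexp_mul hq ξ).coeFn_toLp] with x hx
  rw [modulation, hx, RCLike.inner_apply, map_mul, ← Complex.exp_conj, map_mul, Complex.conj_ofReal,
    Complex.conj_I, inner_smul_right, real_inner_comm, smul_eq_mul]
  have : -2 * Real.pi * ((2 * Real.pi)⁻¹ * ⟪x, ξ⟫) = -⟪x, ξ⟫ := by field_simp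
  rw [this]
  push_cast
  ring_nf

theorem lintegral_enorm_sq_coeFn {E : Type*} [NormedAddCommGroup E]
    (F : Lp E 2 (volume : Measure (EuclideanSpace ℝ (Fin d)))) :
    ∫⁻ x, ‖F x‖ₑ ^ 2 = ENNReal.ofReal (‖F‖ ^ 2) := by
  rw [lintegral_enorm_sq_eq_eLpNorm_sq, ← Lp.enorm_def, ← ofReal_norm,
    ENNReal.ofReal_pow (norm_nonneg _)]

theorem sobolevNormSq_mul_le {q F : EuclideanSpace ℝ (Fin d) → ℂ} {m : ℕ} {C : ℝ}
    (hC : ∀ x, ‖q x‖ ^ 2 * (1 + ‖x‖ ^ 2) ^ m ≤ C) :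
    sobolevNormSq m (fun x => q x * F x) ≤ ENNReal.ofReal C * ∫⁻ x, ‖F x‖ₑ ^ 2 := by
  rw [sobolevNormSq, ← lintegral_const_mul' _ _ ENNReal.ofReal_ne_top]
  refine lintegral_mono fun x => ?_
  simp only
  rw [enorm_mul, mul_pow, ← mul_assoc]
  gcongr
  rw [← ofReal_norm, ← ENNReal.ofReal_pow (norm_nonneg _), ← ENNReal.ofReal_mul (by positivity),
    mul_comm]
  exact ENNReal.ofReal_le_ofReal (hC x)

/-- The modulations of a function of sufficient decay by uniformly separated frequencies form a
Bessel family. -/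
theorem isBesselFamily_modulation [NeZero d] {m : ℕ} (hm : d < 2 * m)
    {q : EuclideanSpace ℝ (Fin d) → ℂ} (hq : MemLp q 2) {C : ℝ}
    (hC : ∀ x, ‖q x‖ ^ 2 * (1 + ‖x‖ ^ 2) ^ m ≤ C) {ι : Type*}
    {y : ι → EuclideanSpace ℝ (Fin d)} {δ : ℝ} (hδ : 0 < δ)
    (hy : Pairwise fun i j => δ ≤ dist (y i) (y j)) :
    IsBesselFamily fun i => modulation hq (y i) := by
  have hpi : (0 : ℝ) < (2 * Real.pi)⁻¹ := by positivity
  obtain ⟨B, hB, H⟩ := exists_sum_enorm_fourier_sq_le hm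
    (y := fun i => (2 * Real.pi)⁻¹ • y i) (δ := (2 * Real.pi)⁻¹ * δ) (by positivity)
    (fun i j hij => by
      simp only
      rw [dist_smul₀, Real.norm_of_nonneg hpi.le]
      exact mul_le_mul_of_nonneg_left (hy hij) hpi.le)
  refine ⟨B.toReal * |C|, fun F s => ?_⟩
  have hC' : ∀ x, ‖conj (q x)‖ ^ 2 * (1 + ‖x‖ ^ 2) ^ m ≤ C := by simpa using hC
  have hle := sobolevNormSq_mul_le (F := F) hC'
  rw [lintegral_enorm_sq_coeFn] at hle
  have hmeas : AEStronglyMeasurable fun x => conj (q x) * F x :=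
    (Complex.continuous_conj.comp_aestronglyMeasurable hq.1).mul (Lp.aestronglyMeasurable F)
  have h1 := (H _ hmeas (hle.trans_lt (by finiteness)) s).trans (mul_le_mul_right hle B)
  simp_rw [← inner_modulation hq] at h1
  have h2 : ∑ i ∈ s, ‖inner ℂ (modulation hq (y i)) F‖ₑ ^ 2 =
      ENNReal.ofReal (∑ i ∈ s, ‖inner ℂ (modulation hq (y i)) F‖ ^ 2) := by
    rw [ENNReal.ofReal_sum_of_nonneg fun i _ => by positivity]
    refine Finset.sum_congr rfl fun i _ => ?_
    rw [← ofReal_norm, ENNReal.ofReal_pow (norm_nonneg _)]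
  rw [h2, ← ENNReal.ofReal_toReal hB.ne, ← mul_assoc,
    ← ENNReal.ofReal_mul ENNReal.toReal_nonneg] at h1
  have h3 : ENNReal.ofReal (B.toReal * C) ≤ ENNReal.ofReal (B.toReal * |C|) :=
    ENNReal.ofReal_le_ofReal (mul_le_mul_of_nonneg_left (le_abs_self C) ENNReal.toReal_nonneg)
  have h4 := h1.trans (mul_le_mul_left h3 _)
  rw [← ENNReal.ofReal_mul (by positivity)] at h4
  exact (ENNReal.ofReal_le_ofReal_iff (by positivity)).1 h4

/-- Multiplication by a bounded continuous function, as an operator on `L²`. -/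
theorem exists_mulOperator {g : EuclideanSpace ℝ (Fin d) → ℂ} (hg : Continuous g) {C : ℝ}
    (hC : ∀ x, ‖g x‖ ≤ C) :
    ∃ M : Lp ℂ 2 (volume : Measure (EuclideanSpace ℝ (Fin d))) →L[ℂ]
        Lp ℂ 2 (volume : Measure (EuclideanSpace ℝ (Fin d))),
      ∀ F, M F =ᵐ[volume] fun x => g x * F x := by
  have hbd : ∀ F : Lp ℂ 2 (volume : Measure (EuclideanSpace ℝ (Fin d))), ∀ᵐ x,
      ‖g x * F x‖ ≤ C * ‖F x‖ := fun F => ae_of_all _ fun x => by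
    rw [norm_mul]; exact mul_le_mul_of_nonneg_right (hC x) (norm_nonneg _)
  have hmem : ∀ F : Lp ℂ 2 (volume : Measure (EuclideanSpace ℝ (Fin d))),
      MemLp (fun x => g x * F x) 2 := fun F =>
    (Lp.memLp F).of_le_mul (hg.aestronglyMeasurable.mul (Lp.aestronglyMeasurable F)) (hbd F)
  let M₀ : Lp ℂ 2 (volume : Measure (EuclideanSpace ℝ (Fin d))) →ₗ[ℂ]
        Lp ℂ 2 (volume : Measure (EuclideanSpace ℝ (Fin d))) :=
    { toFun := fun F => (hmem F).toLp _
      map_add' := fun F G => by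
        refine Lp.ext ?_
        filter_upwards [(hmem (F + G)).coeFn_toLp, (hmem F).coeFn_toLp, (hmem G).coeFn_toLp,
          Lp.coeFn_add F G, Lp.coeFn_add ((hmem F).toLp _) ((hmem G).toLp _)] with x h1 h2 h3 h4 h5
        rw [h1, h5, Pi.add_apply, h2, h3, h4, Pi.add_apply, mul_add]
      map_smul' := fun c F => by
        refine Lp.ext ?_
        filter_upwards [(hmem (c • F)).coeFn_toLp, (hmem F).coeFn_toLp,
          Lp.coeFn_smul c F, Lp.coeFn_smul c ((hmem F).toLp _)] with x h1 h2 h3 h4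
        rw [h1, RingHom.id_apply, h4, Pi.smul_apply, h2, h3, Pi.smul_apply, smul_eq_mul,
          smul_eq_mul, mul_left_comm] }
  refine ⟨M₀.mkContinuous C fun F => ?_, fun F => (hmem F).coeFn_toLp⟩
  refine Lp.norm_le_mul_norm_of_ae_le_mul ?_
  filter_upwards [(hmem F).coeFn_toLp, hbd F] with x h1 h2
  change ‖((hmem F).toLp _) x‖ ≤ _
  rw [h1]
  exact h2

end Modulation

/-! ### The weight `(‖x‖² + ε) ^ k` -/

section Weight

/-- The square root of the weight `(‖x‖² + ε) ^ k`. -/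
noncomputable def sqrtWeight {d : ℕ} (ε : ℝ) (k : ℕ) (x : EuclideanSpace ℝ (Fin d)) : ℝ :=
  Real.sqrt ((‖x‖ ^ 2 + ε) ^ k)

variable {d k : ℕ} {ε : ℝ}

theorem sqrtWeight_pos (hε : 0 < ε) (x : EuclideanSpace ℝ (Fin d)) : 0 < sqrtWeight ε k x :=
  Real.sqrt_pos.2 (by positivity)

theorem sqrtWeight_sq (hε : 0 < ε) (x : EuclideanSpace ℝ (Fin d)) :
    sqrtWeight ε k x ^ 2 = (‖x‖ ^ 2 + ε) ^ k :=
  Real.sq_sqrt (by positivity)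

theorem continuous_sqrtWeight : Continuous (sqrtWeight ε k : EuclideanSpace ℝ (Fin d) → ℝ) := by
  unfold sqrtWeight; fun_prop

theorem continuous_sqrtWeight_inv (hε : 0 < ε) :
    Continuous fun x : EuclideanSpace ℝ (Fin d) => (((sqrtWeight ε k x)⁻¹ : ℝ) : ℂ) :=
  Complex.continuous_ofReal.comp
    (continuous_sqrtWeight.inv₀ fun x => (sqrtWeight_pos hε x).ne')

theorem one_add_norm_sq_pow_le (hε : 0 < ε) (x : EuclideanSpace ℝ (Fin d)) :
    (1 + ‖x‖ ^ 2) ^ k ≤ (1 + ε⁻¹) ^ k * (‖x‖ ^ 2 + ε) ^ k := by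
  rw [← mul_pow]
  refine pow_le_pow_left₀ (by positivity) ?_ k
  have : (1 + ε⁻¹) * (‖x‖ ^ 2 + ε) = 1 + ‖x‖ ^ 2 + (ε + ε⁻¹ * ‖x‖ ^ 2) := by field_simp; ring
  rw [this]
  have : 0 ≤ ε + ε⁻¹ * ‖x‖ ^ 2 := by positivity
  linarith

theorem norm_sqrtWeight_inv_sq (hε : 0 < ε) (x : EuclideanSpace ℝ (Fin d)) :
    ‖(((sqrtWeight ε k x)⁻¹ : ℝ) : ℂ)‖ ^ 2 = ((‖x‖ ^ 2 + ε) ^ k)⁻¹ := by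
  rw [Complex.norm_real, norm_inv, Real.norm_of_nonneg (sqrtWeight_pos hε x).le, inv_pow,
    sqrtWeight_sq hε]

theorem norm_sqrtWeight_inv_sq_mul_le (hε : 0 < ε) (x : EuclideanSpace ℝ (Fin d)) :
    ‖(((sqrtWeight ε k x)⁻¹ : ℝ) : ℂ)‖ ^ 2 * (1 + ‖x‖ ^ 2) ^ k ≤ (1 + ε⁻¹) ^ k := by
  rw [norm_sqrtWeight_inv_sq hε, inv_mul_le_iff₀ (by positivity), mul_comm]
  exact one_add_norm_sq_pow_le hε x

theorem norm_sqrtWeight_inv_le (hε : 0 < ε) (x : EuclideanSpace ℝ (Fin d)) :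
    ‖(((sqrtWeight ε k x)⁻¹ : ℝ) : ℂ)‖ ≤ (1 + ε⁻¹) ^ k := by
  have h1 := norm_sqrtWeight_inv_sq_mul_le (k := k) hε x
  have h2 : (1 : ℝ) ≤ (1 + ‖x‖ ^ 2) ^ k := one_le_pow₀ (by nlinarith [sq_nonneg ‖x‖])
  have h3 : (1 : ℝ) ≤ (1 + ε⁻¹) ^ k := one_le_pow₀ (by have := inv_pos.2 hε; linarith)
  set t := ‖(((sqrtWeight ε k x)⁻¹ : ℝ) : ℂ)‖
  have h4 : t ^ 2 ≤ (1 + ε⁻¹) ^ k := by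
    nlinarith [sq_nonneg t]
  nlinarith [sq_nonneg (t - 1)]

theorem memLp_sqrtWeight_inv (hε : 0 < ε) (hk : d < 2 * k) :
    MemLp (fun x : EuclideanSpace ℝ (Fin d) => (((sqrtWeight ε k x)⁻¹ : ℝ) : ℂ)) 2 := by
  rw [memLp_two_iff_integrable_sq_norm (continuous_sqrtWeight_inv hε).aestronglyMeasurable]
  refine ((integrable_one_add_norm_sq_pow_inv hk).const_mul ((1 + ε⁻¹) ^ k)).mono'
    ((continuous_sqrtWeight_inv hε).norm.pow 2).aestronglyMeasurable (ae_of_all _ fun x => ?_)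
  rw [Real.norm_of_nonneg (by positivity), ← div_eq_mul_inv, le_div_iff₀ (by positivity)]
  exact norm_sqrtWeight_inv_sq_mul_le hε x

end Weight

/-! ### A biorthogonal family for the weighted exponentials -/

section DualFamily

open scoped ComplexConjugate

variable {d k : ℕ} {ε : ℝ}

theorem exists_schwartz_bump {δ : ℝ} (hδ : 0 < δ) :
    ∃ ψ : SchwartzMap (EuclideanSpace ℝ (Fin d)) ℂ, ψ 0 = 1 ∧ ∀ x, δ ≤ ‖x‖ → ψ x = 0 := by
  let b : ContDiffBump (0 : EuclideanSpace ℝ (Fin d)) := ⟨δ / 2, δ, by positivity, by linarith⟩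
  have hc : HasCompactSupport fun x => ((b x : ℝ) : ℂ) :=
    b.hasCompactSupport.comp_left (g := fun t : ℝ => (t : ℂ)) rfl
  refine ⟨hc.toSchwartzMap (Complex.ofRealCLM.contDiff.comp b.contDiff), ?_, fun x hx => ?_⟩
  · change ((b 0 : ℝ) : ℂ) = 1
    rw [b.one_of_mem_closedBall (Metric.mem_closedBall_self b.rIn_pos.le), Complex.ofReal_one]
  · change ((b x : ℝ) : ℂ) = 0
    rw [b.zero_of_le_dist (by rwa [dist_zero_right]), Complex.ofReal_zero]

theorem exists_sqrtWeight_mul_schwartz_bound (hε : 0 < ε) (m : ℕ)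
    (f : SchwartzMap (EuclideanSpace ℝ (Fin d)) ℂ) :
    ∃ C, ∀ x, ‖(sqrtWeight ε k x : ℂ) * f x‖ ^ 2 * (1 + ‖x‖ ^ 2) ^ m ≤ C := by
  set C := 2 ^ (k + m) * (Finset.Iic (k + m, 0)).sup
    (fun p => SchwartzMap.seminorm ℝ p.1 p.2) f with hC
  have hf : ∀ x, (1 + ‖x‖) ^ (k + m) * ‖f x‖ ≤ C := fun x => by
    have := SchwartzMap.one_add_le_sup_seminorm_apply (𝕜 := ℝ) (m := (k + m, 0)) (k := k + m)
      (n := 0) le_rfl le_rfl f x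
    rwa [norm_iteratedFDeriv_zero] at this
  refine ⟨(1 + ε) ^ k * C ^ 2, fun x => ?_⟩
  rw [norm_mul, mul_pow, Complex.norm_real, Real.norm_of_nonneg (sqrtWeight_pos hε x).le,
    sqrtWeight_sq hε]
  have h1 : (‖x‖ ^ 2 + ε) ^ k ≤ (1 + ε) ^ k * ((1 + ‖x‖) ^ 2) ^ k := by
    rw [← mul_pow]
    refine pow_le_pow_left₀ (by positivity) ?_ k
    nlinarith [norm_nonneg x, mul_nonneg hε.le (norm_nonneg x),
      mul_nonneg hε.le (sq_nonneg ‖x‖)]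
  have h2 : (1 + ‖x‖ ^ 2) ^ m ≤ ((1 + ‖x‖) ^ 2) ^ m :=
    pow_le_pow_left₀ (by positivity) (by nlinarith [norm_nonneg x]) m
  calc (‖x‖ ^ 2 + ε) ^ k * ‖f x‖ ^ 2 * (1 + ‖x‖ ^ 2) ^ m
      ≤ (1 + ε) ^ k * ((1 + ‖x‖) ^ 2) ^ k * ‖f x‖ ^ 2 * ((1 + ‖x‖) ^ 2) ^ m := by gcongr
    _ = (1 + ε) ^ k * ((1 + ‖x‖) ^ (k + m) * ‖f x‖) ^ 2 := by
        generalize 1 + ‖x‖ = t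
        ring
    _ ≤ _ := by
        gcongr
        exact hf x

theorem memLp_of_sq_mul_bound {m : ℕ} (hm : d < 2 * m) {q : EuclideanSpace ℝ (Fin d) → ℂ}
    (hq : AEStronglyMeasurable q) {C : ℝ} (hC : ∀ x, ‖q x‖ ^ 2 * (1 + ‖x‖ ^ 2) ^ m ≤ C) :
    MemLp q 2 := by
  rw [memLp_two_iff_integrable_sq_norm hq]
  refine ((integrable_one_add_norm_sq_pow_inv hm).const_mul C).mono'
    (hq.norm.pow 2) (ae_of_all _ fun x => ?_)
  rw [Real.norm_of_nonneg (by positivity), ← div_eq_mul_inv, le_div_iff₀ (by positivity)]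
  exact hC x

/-- The exponentials `e ^ (i ξ·x) (‖x‖² + ε) ^ (-k / 2)` with uniformly separated frequencies have
a biorthogonal Bessel family: the Fourier transforms of translates of a bump function that
separates the knots, multiplied by `(‖x‖² + ε) ^ (k / 2)`. -/
theorem exists_biorthogonal_modulation [NeZero d] (hε : 0 < ε) (hk : d < 2 * k) {ι : Type*}
    [DecidableEq ι] {y : ι → EuclideanSpace ℝ (Fin d)} {δ : ℝ} (hδ : 0 < δ)
    (hy : Pairwise fun i j => δ ≤ dist (y i) (y j)) :
    ∃ p : ι → Lp ℂ 2 (volume : Measure (EuclideanSpace ℝ (Fin d))), IsBesselFamily p ∧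
      ∀ i j, inner ℂ (modulation (memLp_sqrtWeight_inv hε hk) (y i)) (p j) =
        if i = j then 1 else 0 := by
  have hpi : (0 : ℝ) < (2 * Real.pi)⁻¹ := by positivity
  obtain ⟨ψ, hψ0, hψ⟩ := exists_schwartz_bump (d := d) (δ := (2 * Real.pi)⁻¹ * δ) (by positivity)
  obtain ⟨f, hf⟩ : ∃ f : SchwartzMap (EuclideanSpace ℝ (Fin d)) ℂ, 𝓕 f = ψ :=
    ⟨𝓕⁻ ψ, FourierTransform.fourier_fourierInv_eq ψ⟩
  obtain ⟨C, hC⟩ := exists_sqrtWeight_mul_schwartz_bound (k := k) hε k f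
  have hcont : Continuous fun x => (sqrtWeight ε k x : ℂ) * f x :=
    (Complex.continuous_ofReal.comp continuous_sqrtWeight).mul f.continuous
  have hq := memLp_of_sq_mul_bound hk hcont.aestronglyMeasurable hC
  refine ⟨fun i => modulation hq (y i), isBesselFamily_modulation hk hq hC hδ hy, fun i j => ?_⟩
  change inner ℂ _ (modulation hq (y j)) = _
  rw [inner_modulation]
  have e : 𝓕 (fun x => conj ((((sqrtWeight ε k x)⁻¹ : ℝ) : ℂ)) * (modulation hq (y j)) x)
      ((2 * Real.pi)⁻¹ • y i) = 𝓕 (f : EuclideanSpace ℝ (Fin d) → ℂ)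
        ((2 * Real.pi)⁻¹ • (y i - y j)) := by
    rw [Real.fourier_eq', Real.fourier_eq']
    refine integral_congr_ae ?_
    filter_upwards [(memLp_cexp_mul hq (y j)).coeFn_toLp] with x hx
    have hw : (sqrtWeight ε k x : ℂ) ≠ 0 := by exact_mod_cast (sqrtWeight_pos hε x).ne'
    rw [modulation, hx, Complex.conj_ofReal, smul_eq_mul, smul_eq_mul, inner_smul_right,
      inner_smul_right, inner_sub_right, real_inner_comm x (y j)]
    have h1 : -2 * Real.pi * ((2 * Real.pi)⁻¹ * (⟪x, y i⟫ - ⟪x, y j⟫)) =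
        -2 * Real.pi * ((2 * Real.pi)⁻¹ * ⟪x, y i⟫) + ⟪x, y j⟫ := by field_simp; ring
    rw [h1, Complex.ofReal_add, add_mul, Complex.exp_add, Complex.ofReal_inv,
      mul_comm Complex.I ((⟪x, y j⟫ : ℝ) : ℂ)]
    field_simp
  rw [e, ← SchwartzMap.fourier_coe, hf]
  split_ifs with hij
  · rw [hij, sub_self, smul_zero, hψ0]
  · refine hψ _ ?_
    rw [norm_smul, Real.norm_of_nonneg hpi.le, ← dist_eq_norm]
    exact mul_le_mul_of_nonneg_left (hy hij) hpi.le

end DualFamily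

/-! ### Lagrange functions -/

section Lagrange

open scoped ComplexConjugate
open RadonSampling

variable {d k : ℕ} {ε : ℝ}

/-- The translates of `E^k` are, up to a factor, the Gram kernel of the weighted exponentials. -/
theorem fundSol_sub_eq (hε : 0 < ε) (hk : d < 2 * k) (ξ ξ' : Euc d) :
    fundSol d ε k (ξ - ξ') = ((((2 * Real.pi) ^ d)⁻¹ : ℝ) : ℂ) *
      inner ℂ (modulation (memLp_sqrtWeight_inv hε hk) ξ)
        (modulation (memLp_sqrtWeight_inv hε hk) ξ') := by
  rw [fundSol, L2.inner_def, ← integral_neg_eq_self]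
  congr 1
  refine integral_congr_ae ?_
  filter_upwards [(memLp_cexp_mul (memLp_sqrtWeight_inv hε hk) ξ).coeFn_toLp,
    (memLp_cexp_mul (memLp_sqrtWeight_inv hε hk) ξ').coeFn_toLp] with x h1 h2
  rw [modulation, modulation, h1, h2, RCLike.inner_apply, map_mul, ← Complex.exp_conj, map_mul,
    Complex.conj_ofReal, Complex.conj_ofReal, Complex.conj_I, norm_neg, inner_neg_right,
    inner_sub_left, ← sqrtWeight_sq hε]
  have h3 : Complex.exp (Complex.I * ((-(⟪ξ, x⟫ - ⟪ξ', x⟫) : ℝ) : ℂ)) =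
      Complex.exp (Complex.I * (⟪ξ', x⟫ : ℝ)) * Complex.exp (-Complex.I * (⟪ξ, x⟫ : ℝ)) := by
    rw [← Complex.exp_add]
    congr 1
    push_cast
    ring
  rw [h3]
  push_cast
  ring

/-- The Fourier transform on `L²` of `M F`, where `M` is multiplication by `(‖x‖² + ε) ^ (-k / 2)`,
is given by the inner products of `F` with the weighted exponentials. -/
theorem ae_fourier_mul_eq_inner (hε : 0 < ε) (hk : d < 2 * k)
    {F G : Lp ℂ 2 (volume : Measure (Euc d))}
    (hG : G =ᵐ[volume] fun x => (((sqrtWeight ε k x)⁻¹ : ℝ) : ℂ) * F x) :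
    ∀ᵐ ξ : Euc d, (𝓕 G : Lp ℂ 2 (volume : Measure (Euc d))) ((2 * Real.pi)⁻¹ • ξ) =
      inner ℂ (modulation (memLp_sqrtWeight_inv hε hk) ξ) F := by
  have hi : Integrable fun x => (((sqrtWeight ε k x)⁻¹ : ℝ) : ℂ) * F x :=
    (memLp_sqrtWeight_inv hε hk).integrable_mul (Lp.memLp F)
  have hL : MemLp (fun x => (((sqrtWeight ε k x)⁻¹ : ℝ) : ℂ) * F x) 2 := (Lp.memLp G).ae_eq hG
  have hGe : G = hL.toLp _ := Lp.ext (hG.trans hL.coeFn_toLp.symm)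
  have h := ae_comp_smul (c := (2 * Real.pi)⁻¹) (by positivity) (fourier_toLp_ae_eq hi hL)
  filter_upwards [h] with ξ hξ
  rw [hGe, hξ, inner_modulation]
  simp only [Complex.conj_ofReal]

/-- Lagrange functions correspond to the elements `T b` of the range of the synthesis operator `T`
of the weighted exponentials of the knots that are orthogonal to all but one of them. -/
theorem isLagrange_iff_exists_synthesis (hε : 0 < ε) (hk : d < 2 * k) {Ξ : Set (Euc d)}
    [DecidableEq Ξ]
    {T : lp (fun _ : Ξ => ℂ) 2 →L[ℂ] Lp ℂ 2 (volume : Measure (Euc d))}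
    (hT : ∀ b : lp (fun _ : Ξ => ℂ) 2,
      HasSum (fun ν : Ξ => b ν • modulation (memLp_sqrtWeight_inv hε hk) (ν : Euc d)) (T b))
    (ν : Ξ) (L : Euc d → ℂ) :
    IsLagrange ε Ξ k ν L ↔ ∃ b : lp (fun _ : Ξ => ℂ) 2,
      (∀ ξ, L ξ = inner ℂ (modulation (memLp_sqrtWeight_inv hε hk) ξ) (T b)) ∧
      ∀ γ : Ξ, inner ℂ (modulation (memLp_sqrtWeight_inv hε hk) (γ : Euc d)) (T b) =
        if γ = ν then 1 else 0 := by
  have hp : ((((2 * Real.pi) ^ d)⁻¹ : ℝ) : ℂ) ≠ 0 := by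
    exact_mod_cast (inv_pos.2 (pow_pos Real.two_pi_pos d)).ne'
  -- A coefficient sequence `a` of `L` corresponds to `b = (2π)⁻ᵈ a`.
  have hsum : ∀ (b : lp (fun _ : Ξ => ℂ) 2) (ξ : Euc d),
      HasSum (fun μ : Ξ => (((((2 * Real.pi) ^ d)⁻¹ : ℝ) : ℂ)⁻¹ * b μ) * fundSol d ε k (ξ - μ))
        (inner ℂ (modulation (memLp_sqrtWeight_inv hε hk) ξ) (T b)) := by
    intro b ξ
    have h := (hT b).mapL (innerSL ℂ (modulation (memLp_sqrtWeight_inv hε hk) ξ))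
    refine h.congr_fun fun μ => ?_
    rw [innerSL_apply_apply, inner_smul_right, fundSol_sub_eq hε hk]
    field_simp
  have hval : ∀ L : Euc d → ℂ, (L ν = 1 ∧ ∀ γ : Ξ, γ ≠ ν → L γ = 0) ↔
      ∀ γ : Ξ, L γ = if γ = ν then 1 else 0 := by
    intro L
    constructor
    · rintro ⟨h1, h2⟩ γ
      split_ifs with h
      · rw [h, h1]
      · exact h2 γ h
    · intro h
      exact ⟨by simp [h], fun γ hγ => by simp [h, hγ]⟩
  rw [IsLagrange, hval]
  constructor
  · rintro ⟨⟨a, ha, hL⟩, hγ⟩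
    have hmem : Memℓp (fun μ => ((((2 * Real.pi) ^ d)⁻¹ : ℝ) : ℂ) * a μ) 2 := by
      refine memℓp_gen ?_
      simp only [ENNReal.toReal_ofNat, Real.rpow_ofNat, norm_mul, mul_pow]
      exact ha.mul_left _
    have hLb : ∀ ξ, L ξ = inner ℂ (modulation (memLp_sqrtWeight_inv hε hk) ξ) (T ⟨_, hmem⟩) := by
      intro ξ
      refine (hL ξ).unique ((hsum ⟨_, hmem⟩ ξ).congr_fun fun μ => ?_)
      simp only
      rw [inv_mul_cancel_left₀ hp]
    exact ⟨⟨_, hmem⟩, hLb, fun γ => by rw [← hLb, hγ]⟩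
  · rintro ⟨b, hL, hb⟩
    refine ⟨⟨fun μ => ((((2 * Real.pi) ^ d)⁻¹ : ℝ) : ℂ)⁻¹ * b μ, ?_, fun ξ => ?_⟩, fun γ => ?_⟩
    · have := (lp.memℓp b).summable (by simp)
      simp only [ENNReal.toReal_ofNat, Real.rpow_ofNat] at this
      simp only [norm_mul, mul_pow]
      exact this.mul_left _
    · rw [hL]; exact hsum b ξ
    · rw [hL, hb]

end Lagrange

/-! ### The Fourier slice theorem -/

section FourierSlice

open RadonSampling

variable {d : ℕ}

/-- Lebesgue measure is the product of the Lebesgue measures of a line and of its orthogonal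
complement. -/
theorem measurePreserving_smul_add {θ : Euc d} (hθ : ‖θ‖ = 1) :
    MeasurePreserving (fun p : ℝ × (ℝ ∙ θ)ᗮ => p.1 • θ + (p.2 : Euc d))
      ((volume : Measure ℝ).prod (measureSpaceOfInnerProductSpace.volume))
      (volume : Measure (Euc d)) := by
  have h1 := (LinearIsometryEquiv.toSpanUnitSingleton θ hθ).measurePreserving
  have h2 := h1.prod (MeasurePreserving.id
    (measureSpaceOfInnerProductSpace.volume : Measure (ℝ ∙ θ)ᗮ))
  have h3 := WithLp.volume_preserving_toLp (ℝ ∙ θ) (ℝ ∙ θ)ᗮ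
  have h4 := ((ℝ ∙ θ).orthogonalDecomposition.symm).measurePreserving
  have h5 := (h4.comp h3).comp h2
  exact h5

theorem integral_radon_mul_cexp {φ : Euc d → ℂ} (hφ : Continuous φ) (hc : HasCompactSupport φ)
    {θ : Euc d} (hθ : ‖θ‖ = 1) (τ : ℝ) :
    ∫ s : ℝ, radon φ θ s * Complex.exp (-(Complex.I * ((s * τ : ℝ) : ℂ))) =
      ∫ x, φ x * Complex.exp (-(Complex.I * ((⟪θ, x⟫ * τ : ℝ) : ℂ))) := by
  have hmp := measurePreserving_smul_add hθ
  set g : Euc d → ℂ := fun x => φ x * Complex.exp (-(Complex.I * ((⟪θ, x⟫ * τ : ℝ) : ℂ))) with hg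
  have hgi : Integrable g :=
    Continuous.integrable_of_hasCompactSupport (by fun_prop) hc.mul_right
  have hi := (hmp.integrable_comp hgi.1).2 hgi
  have e : ∫ x, g x = ∫ p : ℝ × (ℝ ∙ θ)ᗮ, g (p.1 • θ + (p.2 : Euc d))
      ∂((volume : Measure ℝ).prod (measureSpaceOfInnerProductSpace.volume)) := by
    rw [← hmp.map_eq, integral_map hmp.aemeasurable (by rw [hmp.map_eq]; exact hgi.1)]
  rw [e]
  refine Eq.trans ?_ (integral_prod _ hi).symm
  refine integral_congr_ae (ae_of_all _ fun s => ?_)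
  simp only [radon]
  rw [← integral_mul_const]
  refine integral_congr_ae (ae_of_all _ fun y => ?_)
  have : ⟪θ, s • θ + (y : Euc d)⟫ = s := by
    rw [inner_add_right, inner_smul_right, real_inner_self_eq_norm_sq, hθ,
      Submodule.mem_orthogonal_singleton_iff_inner_right.1 y.2]
    simp
  simp only [hg, Function.comp_apply, this]

theorem norm_direction [NeZero d] (ξ : Euc d) : ‖direction ξ‖ = 1 := by
  classical
  rw [direction]
  split_ifs with h
  · simp
  · rw [norm_smul, norm_inv, norm_norm, inv_mul_cancel₀ (norm_ne_zero_iff.2 h)]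

theorem norm_smul_direction [NeZero d] (ξ : Euc d) : ‖ξ‖ • direction ξ = ξ := by
  classical
  rw [direction]
  split_ifs with h
  · simp [h]
  · rw [smul_smul, mul_inv_cancel₀ (norm_ne_zero_iff.2 h), one_smul]

/-- The Fourier slice theorem: up to normalization, the Fourier transform of `Rφ` in the second
variable is the Fourier transform of `φ`. -/
theorem radonFourierAt_eq_fourier [NeZero d] {φ : Euc d → ℂ} (hφ : Continuous φ)
    (hc : HasCompactSupport φ) (ξ : Euc d) :
    radonFourierAt φ ξ =
      (((2 * Real.pi) ^ (-(1 : ℝ) / 2) : ℝ) : ℂ) * 𝓕 φ ((2 * Real.pi)⁻¹ • ξ) := by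
  rw [radonFourierAt, radonFourier, integral_radon_mul_cexp hφ hc (norm_direction ξ),
    Real.fourier_eq']
  congr 1
  refine integral_congr_ae (ae_of_all _ fun x => ?_)
  have h : ⟪direction ξ, x⟫ * ‖ξ‖ = ⟪x, ξ⟫ := by
    conv_rhs => rw [← norm_smul_direction ξ]
    rw [inner_smul_right, real_inner_comm, mul_comm]
  simp only
  rw [h, inner_smul_right, smul_eq_mul, mul_comm]
  have : -2 * Real.pi * ((2 * Real.pi)⁻¹ * ⟪x, ξ⟫) = -⟪x, ξ⟫ := by field_simp
  rw [this]
  push_cast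
  ring_nf

/-- The Plancherel theorem for the Radon transform, as an inequality. -/
theorem norm_toLp_le_radonNorm [NeZero d] {φ : Euc d → ℂ} (hφ : Continuous φ)
    (hc : HasCompactSupport φ) (h2 : MemLp φ 2) : ‖h2.toLp φ‖ ≤ radonNorm φ := by
  have hp := Real.two_pi_pos
  have hi : Integrable φ := hφ.integrable_of_hasCompactSupport hc
  have hsq : eLpNorm (radonFourierAt φ) 2 volume ^ 2 =
      ENNReal.ofReal ((2 * Real.pi) ^ ((d : ℝ) - 1)) * eLpNorm φ 2 volume ^ 2 := by
    rw [← lintegral_enorm_sq_eq_eLpNorm_sq, ← lintegral_enorm_sq_eq_eLpNorm_sq]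
    have e1 : ∀ ξ, ‖radonFourierAt φ ξ‖ₑ ^ 2 =
        ENNReal.ofReal ((2 * Real.pi)⁻¹) * ‖𝓕 φ ((2 * Real.pi)⁻¹ • ξ)‖ₑ ^ 2 := fun ξ => by
      rw [radonFourierAt_eq_fourier hφ hc, enorm_mul, mul_pow]
      congr 1
      rw [← ofReal_norm, Complex.norm_real, Real.norm_of_nonneg (by positivity),
        ← ENNReal.ofReal_pow (by positivity), ← Real.rpow_natCast, ← Real.rpow_mul hp.le,
        ← Real.rpow_neg_one]
      norm_num
    simp_rw [e1]
    rw [lintegral_const_mul' _ _ ENNReal.ofReal_ne_top,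
      lintegral_comp_smul_eq hp (fun x => ‖𝓕 φ x‖ₑ ^ 2), lintegral_enorm_fourier_sq hi h2,
      ← mul_assoc, ← ENNReal.ofReal_mul (by positivity), ← Real.rpow_neg_one, ← Real.rpow_natCast,
      ← Real.rpow_add hp]
    congr 3
    ring
  have h1 : (1 : ℝ≥0∞) ≤ ENNReal.ofReal ((2 * Real.pi) ^ ((d : ℝ) - 1)) := by
    rw [ENNReal.one_le_ofReal]
    refine Real.one_le_rpow (by linarith [Real.pi_gt_three]) ?_
    have : (1 : ℝ) ≤ d := by exact_mod_cast NeZero.one_le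
    linarith
  have hfin : eLpNorm (radonFourierAt φ) 2 volume ≠ ⊤ := by
    intro h
    rw [h] at hsq
    have := ENNReal.mul_lt_top (ENNReal.ofReal_lt_top (r := (2 * Real.pi) ^ ((d : ℝ) - 1)))
      (ENNReal.pow_lt_top (n := 2) h2.2)
    rw [← hsq] at this
    simp at this
  rw [Lp.norm_toLp, radonNorm, ENNReal.toReal_le_toReal h2.2.ne hfin]
  have : eLpNorm φ 2 volume ^ 2 ≤ eLpNorm (radonFourierAt φ) 2 volume ^ 2 := by
    rw [hsq]; exact le_mul_of_one_le_left zero_le h1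
  exact (ENNReal.pow_le_pow_left_iff two_ne_zero).1 this

end FourierSlice

/-! ### The functions `Λ^k_ν` and the expansion of `φ` -/

section DualLagrange

open RadonSampling

variable {d k : ℕ} {ε : ℝ}

/-- If `L` is given by the inner products of `F` with the weighted exponentials, then its inverse
Fourier transform is, up to normalization, `(‖x‖² + ε) ^ (-k / 2) F`. -/
theorem isFourierOf_iff (hε : 0 < ε) (hk : d < 2 * k)
    {F G : Lp ℂ 2 (volume : Measure (Euc d))}
    (hG : G =ᵐ[volume] fun x => (((sqrtWeight ε k x)⁻¹ : ℝ) : ℂ) * F x) {L : Euc d → ℂ}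
    (hL : ∀ ξ, L ξ = inner ℂ (modulation (memLp_sqrtWeight_inv hε hk) ξ) F)
    (Λ : Lp ℂ 2 (volume : Measure (Euc d))) :
    IsFourierOf L Λ ↔ Λ = (((2 * Real.pi) ^ ((d : ℝ) / 2) : ℝ) : ℂ) • G := by
  have hp := Real.two_pi_pos
  have hcc : (((2 * Real.pi) ^ (-(d : ℝ) / 2) : ℝ) : ℂ) =
      (((2 * Real.pi) ^ ((d : ℝ) / 2) : ℝ) : ℂ)⁻¹ := by
    rw [neg_div, Real.rpow_neg hp.le, Complex.ofReal_inv]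
  have hc0 : (((2 * Real.pi) ^ ((d : ℝ) / 2) : ℝ) : ℂ) ≠ 0 := by
    exact_mod_cast (Real.rpow_pos_of_pos hp _).ne'
  have hFG := ae_fourier_mul_eq_inner hε hk hG
  rw [IsFourierOf, hcc]
  generalize (((2 * Real.pi) ^ ((d : ℝ) / 2) : ℝ) : ℂ) = c at hc0
  constructor
  · intro h
    have h1 : ∀ᵐ ξ : Euc d, (𝓕 G : Lp ℂ 2 (volume : Measure (Euc d))) ((2 * Real.pi)⁻¹ • ξ) =
        c⁻¹ * (𝓕 Λ : Lp ℂ 2 (volume : Measure (Euc d))) ((2 * Real.pi)⁻¹ • ξ) := by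
      filter_upwards [h, hFG] with ξ h1 h2
      rw [h2, ← hL, h1]
    have h2 := ae_comp_smul hp.ne' h1
    simp only [smul_smul, inv_mul_cancel₀ hp.ne', one_smul] at h2
    have h3 : 𝓕 G = 𝓕 (c⁻¹ • Λ) := by
      rw [FourierTransform.fourier_smul]
      refine Lp.ext ?_
      filter_upwards [h2, Lp.coeFn_smul c⁻¹ (𝓕 Λ)] with x h4 h5
      rw [h4, h5, Pi.smul_apply, smul_eq_mul]
    rw [(Lp.fourierTransformₗᵢ (Euc d) ℂ).injective h3, smul_smul, mul_inv_cancel₀ hc0, one_smul]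
  · rintro rfl
    rw [FourierTransform.fourier_smul]
    have h1 := ae_comp_smul (inv_pos.2 hp).ne' (Lp.coeFn_smul c (𝓕 G))
    filter_upwards [hFG, h1] with ξ h2 h3
    rw [h3, Pi.smul_apply, smul_eq_mul, inv_mul_cancel_left₀ hc0, h2, hL]

/-- Uniqueness of the Lagrange function holds because a coefficient sequence `b` is determined by
the inner products of `T b` with the weighted exponentials of the knots. -/
theorem isDualLagrange_iff (hε : 0 < ε) (hk : d < 2 * k) {Ξ : Set (Euc d)} [DecidableEq Ξ]
    {T : lp (fun _ : Ξ => ℂ) 2 →L[ℂ] Lp ℂ 2 (volume : Measure (Euc d))}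
    (hT : ∀ b : lp (fun _ : Ξ => ℂ) 2,
      HasSum (fun ν : Ξ => b ν • modulation (memLp_sqrtWeight_inv hε hk) (ν : Euc d)) (T b))
    (hinj : ∀ b, (∀ μ : Ξ,
      inner ℂ (modulation (memLp_sqrtWeight_inv hε hk) (μ : Euc d)) (T b) = 0) → b = 0)
    {ν : Ξ} {a : lp (fun _ : Ξ => ℂ) 2}
    (ha : ∀ μ : Ξ, inner ℂ (modulation (memLp_sqrtWeight_inv hε hk) (μ : Euc d)) (T a) =
      if μ = ν then 1 else 0)
    {G : Lp ℂ 2 (volume : Measure (Euc d))}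
    (hG : G =ᵐ[volume] fun x => (((sqrtWeight ε k x)⁻¹ : ℝ) : ℂ) * T a x)
    (Λ : Lp ℂ 2 (volume : Measure (Euc d))) :
    IsDualLagrange ε Ξ k ν Λ ↔ Λ = (((2 * Real.pi) ^ ((d : ℝ) / 2) : ℝ) : ℂ) • G := by
  constructor
  · rintro ⟨L, hL, hLΛ⟩
    obtain ⟨b, hb, hbγ⟩ := (isLagrange_iff_exists_synthesis hε hk hT ν L).1 hL
    have hba : b = a := by
      refine sub_eq_zero.1 (hinj _ fun μ => ?_)
      rw [map_sub, inner_sub_right, hbγ, ha, sub_self]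
    rw [hba] at hb
    exact (isFourierOf_iff hε hk hG hb Λ).1 hLΛ
  · intro h
    exact ⟨_, (isLagrange_iff_exists_synthesis hε hk hT ν _).2 ⟨a, fun ξ => rfl, ha⟩,
      (isFourierOf_iff hε hk hG (fun ξ => rfl) Λ).2 h⟩

theorem memLp_ofReal_mul {φ : Euc d → ℂ} (hφ : Continuous φ) (hc : HasCompactSupport φ)
    {g : Euc d → ℝ} (hg : Continuous g) : MemLp (fun x => (g x : ℂ) * φ x) 2 :=
  Continuous.memLp_of_hasCompactSupport (by fun_prop) hc.mul_left

set_option maxHeartbeats 1000000 in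
/-- The functions `Λ^k_ν` exist and are unique, and the series with the samples of `φ̂` as
coefficients represents `φ` up to a remainder `r` whose Fourier transform vanishes on the knots.
The weighted norm `b` of the remainder satisfies the estimate `b² ≤ ‖r‖ ‖(‖x‖² + ε) ^ k φ‖`, since
the remainder is an orthogonal projection of `φ` with respect to the weighted inner product. -/
theorem exists_dualLagrange_expansion [NeZero d] (hε : 0 < ε) (hk : d < 2 * k)
    {Ξ : Set (Euc d)} (hΞ : UniformlySeparated Ξ) :
    ∃ Λ₀ : Ξ → Lp ℂ 2 (volume : Measure (Euc d)),
      (∀ ν Λ, IsDualLagrange ε Ξ k ν Λ ↔ Λ = Λ₀ ν) ∧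
      ∀ (φ : Euc d → ℂ) (_ : Continuous φ) (_ : HasCompactSupport φ) (h2 : MemLp φ 2)
        (hΦ : MemLp (fun x => (((‖x‖ ^ 2 + ε) ^ k : ℝ) : ℂ) * φ x) 2),
        ∃ (r : Lp ℂ 2 (volume : Measure (Euc d))) (b : ℝ), 0 ≤ b ∧
          HasSum (fun ν : Ξ => 𝓕 φ ((2 * Real.pi)⁻¹ • (ν : Euc d)) • Λ₀ ν)
            ((((2 * Real.pi) ^ ((d : ℝ) / 2) : ℝ) : ℂ) • (h2.toLp φ - r)) ∧
          (∀ ξ ∈ Ξ, 𝓕 (r : Euc d → ℂ) ((2 * Real.pi)⁻¹ • ξ) = 0) ∧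
          ∫⁻ x, ENNReal.ofReal ((‖x‖ ^ 2 + ε) ^ k) * ‖r x‖ₑ ^ 2 = ENNReal.ofReal (b ^ 2) ∧
          b ^ 2 ≤ ‖r‖ * ‖hΦ.toLp _‖ := by
  classical
  obtain ⟨δ, hδ, hsep⟩ := hΞ
  have hy : Pairwise fun i j : Ξ => δ ≤ dist (i : Euc d) j := fun i j hij =>
    hsep i.2 j.2 (Subtype.coe_injective.ne hij)
  have hw := memLp_sqrtWeight_inv (d := d) hε hk
  have hv : IsBesselFamily fun ν : Ξ => modulation (memLp_sqrtWeight_inv hε hk) (ν : Euc d) :=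
    isBesselFamily_modulation hk hw (norm_sqrtWeight_inv_sq_mul_le hε) hδ hy
  obtain ⟨p, hp, hvp⟩ := exists_biorthogonal_modulation hε hk hδ hy
  obtain ⟨T, a, P, hT, ha, hinj, hP, hPv, hPo⟩ := exists_biorthogonal_expansion hv hp hvp
  obtain ⟨M, hM⟩ := exists_mulOperator (continuous_sqrtWeight_inv (d := d) (k := k) hε)
    (norm_sqrtWeight_inv_le hε)
  refine ⟨fun ν => (((2 * Real.pi) ^ ((d : ℝ) / 2) : ℝ) : ℂ) • M (T (a ν)), fun ν Λ =>
    isDualLagrange_iff hε hk hT hinj (fun μ => ha μ ν) (hM (T (a ν))) Λ, ?_⟩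
  intro φ hφ hc h2 hΦ
  have hF : MemLp (fun x => (sqrtWeight ε k x : ℂ) * φ x) 2 :=
    memLp_ofReal_mul hφ hc continuous_sqrtWeight
  have hw0 : ∀ x : Euc d, (sqrtWeight ε k x : ℂ) ≠ 0 := fun x => by
    exact_mod_cast (sqrtWeight_pos hε x).ne'
  -- With `w = (‖x‖² + ε) ^ (k / 2)`, `F = w φ` and `M` the multiplication by `w⁻¹`, the remainder
  -- is `M (F - P F)`; the estimate for its weighted norm is `⟪F - P F, F - P F⟫ = ⟪F - P F, F⟫`,
  -- where one factor `w` is moved from one side of the last inner product to the other.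
  set F := hF.toLp _ with hFdef
  have hMF : M F = h2.toLp φ := by
    refine Lp.ext ?_
    filter_upwards [hM F, hF.coeFn_toLp, h2.coeFn_toLp] with x e1 e2 e3
    rw [e1, e3, hFdef, e2, Complex.ofReal_inv, inv_mul_cancel_left₀ (hw0 x)]
  have hin : ∀ ξ : Euc d, inner ℂ (modulation (memLp_sqrtWeight_inv hε hk) ξ) F =
      𝓕 φ ((2 * Real.pi)⁻¹ • ξ) := fun ξ => by
    rw [inner_modulation, Real.fourier_eq, Real.fourier_eq]
    refine integral_congr_ae ?_
    filter_upwards [hF.coeFn_toLp] with x e1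
    rw [hFdef, e1, Complex.conj_ofReal, Complex.ofReal_inv, inv_mul_cancel_left₀ (hw0 x)]
  refine ⟨M (F - P F), ‖F - P F‖, norm_nonneg _, ?_, fun ξ hξ => ?_, ?_, ?_⟩
  · have h := ((hP F).mapL M).const_smul (((2 * Real.pi) ^ ((d : ℝ) / 2) : ℝ) : ℂ)
    rw [map_sub, hMF, sub_sub_cancel]
    refine h.congr_fun fun ν => ?_
    rw [hin, map_smul, smul_comm]
  · rw [← hPv F ⟨ξ, hξ⟩, inner_modulation, Real.fourier_eq, Real.fourier_eq]
    refine integral_congr_ae ?_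
    filter_upwards [hM (F - P F)] with x e1
    rw [e1, Complex.conj_ofReal]
  · rw [← lintegral_enorm_sq_coeFn]
    refine lintegral_congr_ae ?_
    filter_upwards [hM (F - P F)] with x e1
    rw [e1, enorm_mul, mul_pow, ← mul_assoc, ← ofReal_norm (_ : ℂ),
      ← ENNReal.ofReal_pow (norm_nonneg _), norm_sqrtWeight_inv_sq hε,
      ← ENNReal.ofReal_mul (by positivity), mul_inv_cancel₀ (by positivity), ENNReal.ofReal_one,
      one_mul]
  · have e : inner ℂ (F - P F) (F - P F) = inner ℂ (M (F - P F)) (hΦ.toLp _) := by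
      rw [inner_sub_right, hPo, sub_zero, L2.inner_def, L2.inner_def]
      refine integral_congr_ae ?_
      filter_upwards [hM (F - P F), hF.coeFn_toLp, hΦ.coeFn_toLp] with x e1 e2 e3
      rw [e1, e3, e2, RCLike.inner_apply, RCLike.inner_apply, map_mul, Complex.conj_ofReal,
        ← sqrtWeight_sq hε]
      have := hw0 x
      push_cast
      field_simp
    have e' : ‖F - P F‖ ^ 2 = RCLike.re (inner ℂ (F - P F) (F - P F)) :=
      (inner_self_eq_norm_sq _).symm
    rw [e', e]
    exact (RCLike.re_le_norm _).trans (norm_inner_le_norm _ _)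

end DualLagrange

/-! ### The error bound -/

section ErrorBound

open RadonSampling

variable {d : ℕ} {ε : ℝ}

theorem RadonSampling.IsKnotSet.exists_dist_le {lam : ℝ} {Ξ : Set (Euc d)} (h : IsKnotSet lam Ξ)
    (hlam : 0 ≤ lam) (x : Euc d) : ∃ ξ ∈ Ξ, dist x ξ ≤ lam := by
  obtain ⟨Q, -, hQ, -, hdiam, -, hcov⟩ := h.exists_cells
  have hx : x ∈ ⋃ ξ ∈ Ξ, closure (Q ξ) := by rw [hcov]; trivial
  simp only [Set.mem_iUnion] at hx
  obtain ⟨ξ, hξ, hxQ⟩ := hx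
  refine ⟨ξ, hξ, ?_⟩
  have hmem : ξ ∈ Q ξ := by
    have : ξ ∈ Q ξ ∩ Ξ := by rw [hQ ξ hξ]; rfl
    exact this.1
  have h1 : edist x ξ ≤ ENNReal.ofReal lam := by
    refine le_trans ?_ (hdiam ξ hξ)
    rw [← Metric.ediam_closure]
    exact Metric.edist_le_ediam_of_mem hxQ (subset_closure hmem)
  rw [edist_dist] at h1
  exact (ENNReal.ofReal_le_ofReal_iff hlam).1 h1

theorem sobolevNormSq_le_weighted {k : ℕ} (hε : 0 < ε) (u : Euc d → ℂ) :
    sobolevNormSq k u ≤ ENNReal.ofReal ((1 + ε⁻¹) ^ k) *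
      ∫⁻ x, ENNReal.ofReal ((‖x‖ ^ 2 + ε) ^ k) * ‖u x‖ₑ ^ 2 := by
  rw [sobolevNormSq, ← lintegral_const_mul' _ _ ENNReal.ofReal_ne_top]
  refine lintegral_mono fun x => ?_
  simp only
  rw [← mul_assoc, ← ENNReal.ofReal_mul (by positivity)]
  gcongr
  exact one_add_norm_sq_pow_le hε x

theorem sq_add_le {σ : ℝ} (hε : 0 < ε) (hσ : 0 < σ) :
    σ ^ 2 + ε ≤ (1 + ε⁻¹) * (σ + ε) ^ 2 := by
  have : (1 + ε⁻¹) * (σ + ε) ^ 2 =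
      σ ^ 2 + ε + (2 * σ * ε + ε ^ 2 + ε⁻¹ * σ ^ 2 + 2 * σ) := by field_simp; ring
  rw [this]
  have : 0 ≤ 2 * σ * ε + ε ^ 2 + ε⁻¹ * σ ^ 2 + 2 * σ := by positivity
  linarith

theorem norm_toLp_weight_mul_le {k : ℕ} {σ : ℝ} (hε : 0 < ε) {φ : Euc d → ℂ}
    (hφ : tsupport φ ⊆ Metric.closedBall 0 σ) (h2 : MemLp φ 2)
    (hΦ : MemLp (fun x => (((‖x‖ ^ 2 + ε) ^ k : ℝ) : ℂ) * φ x) 2) :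
    ‖hΦ.toLp _‖ ≤ (σ ^ 2 + ε) ^ k * ‖h2.toLp φ‖ := by
  refine Lp.norm_le_mul_norm_of_ae_le_mul ?_
  filter_upwards [hΦ.coeFn_toLp, h2.coeFn_toLp] with x e1 e2
  rw [e1, e2, norm_mul, Complex.norm_real, Real.norm_of_nonneg (by positivity)]
  by_cases hx : φ x = 0
  · simp [hx]
  · have hxσ : ‖x‖ ≤ σ := mem_closedBall_zero_iff.1 (hφ (subset_tsupport φ hx))
    gcongr

/-- The doubling of the order of approximation: for the norm `n` and the weighted norm `b` of a
remainder, `n ≤ t b` and `b² ≤ n N` combine to a bound with the factor `t²`. -/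
theorem le_pow_mul_of_sq_le {n b N t : ℝ} (hn : 0 ≤ n) (h1 : n ≤ t * b)
    (h2 : b ^ 2 ≤ n * N) (hN : 0 ≤ N) : n ≤ t ^ 2 * N := by
  rcases hn.eq_or_lt with h | h
  · rw [← h]; positivity
  · have h3 : n ^ 2 ≤ t ^ 2 * b ^ 2 := by
      rw [← mul_pow]; exact pow_le_pow_left₀ hn h1 2
    have h4 : t ^ 2 * b ^ 2 ≤ t ^ 2 * (n * N) := mul_le_mul_of_nonneg_left h2 (sq_nonneg t)
    refine le_of_mul_le_mul_left ?_ h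
    nlinarith

/-- The sampling inequality in terms of the unitary Fourier transform and the weight
`(‖x‖² + ε) ^ k`. -/
theorem exists_norm_le_of_fourier_eq_zero [NeZero d] (hε : 0 < ε) :
    ∃ C : ℝ, 0 < C ∧ ∀ (lam : ℝ) (Ξ : Set (Euc d)), 0 < lam → (∀ x, ∃ ξ ∈ Ξ, dist x ξ ≤ lam) →
      ∀ k, d / 2 + 1 ≤ k → ∀ (r : Lp ℂ 2 (volume : Measure (Euc d))) (b : ℝ), 0 ≤ b →
        (∀ ξ ∈ Ξ, 𝓕 (r : Euc d → ℂ) ((2 * Real.pi)⁻¹ • ξ) = 0) →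
        ∫⁻ x, ENNReal.ofReal ((‖x‖ ^ 2 + ε) ^ k) * ‖r x‖ₑ ^ 2 = ENNReal.ofReal (b ^ 2) →
        ‖r‖ ≤ (C * lam) ^ k * b := by
  have hp := Real.two_pi_pos
  obtain ⟨C, hC, H⟩ := exists_sampling_inequality (d := d) (m := d / 2 + 1) (by omega)
  refine ⟨C * (2 * Real.pi)⁻¹, by positivity, fun lam Ξ hlam hcov k hk r b hb hr hrb => ?_⟩
  have h := H ((2 * Real.pi)⁻¹ * lam) ((fun ξ => (2 * Real.pi)⁻¹ • ξ) '' Ξ) (by positivity)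
    (fun x => by
      obtain ⟨ξ, hξ, hx⟩ := hcov ((2 * Real.pi) • x)
      refine ⟨_, ⟨ξ, hξ, rfl⟩, ?_⟩
      have : x = (2 * Real.pi)⁻¹ • (2 * Real.pi) • x := by
        rw [smul_smul, inv_mul_cancel₀ hp.ne', one_smul]
      rw [this, dist_smul₀, Real.norm_of_nonneg (by positivity)]
      gcongr)
    k hk r (Lp.aestronglyMeasurable r)
    ((sobolevNormSq_le_weighted hε _).trans_lt (by rw [hrb]; finiteness))
    (by rintro _ ⟨ξ, hξ, rfl⟩; exact hr ξ hξ)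
  have hle : ∫⁻ x, ENNReal.ofReal (‖x‖ ^ (2 * k)) * ‖r x‖ₑ ^ 2 ≤ ENNReal.ofReal (b ^ 2) := by
    rw [← hrb]
    refine lintegral_mono fun x => ?_
    rw [pow_mul]
    gcongr
    linarith
  have h3 := h.trans (mul_le_mul_right hle _)
  rw [lintegral_enorm_sq_coeFn, ← ENNReal.ofReal_mul (by positivity),
    ENNReal.ofReal_le_ofReal_iff (by positivity), mul_comm 2 k, pow_mul, ← mul_pow,
    ← mul_assoc] at h3
  exact le_of_sq_le_sq h3 (by positivity)

/-- The error bound for the expansions of compactly supported functions. -/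
theorem exists_norm_remainder_le [NeZero d] (hε : 0 < ε) :
    ∃ c : ℝ, 0 < c ∧ ∀ (lam : ℝ) (Ξ : Set (Euc d)), 0 < lam → (∀ x, ∃ ξ ∈ Ξ, dist x ξ ≤ lam) →
      ∀ k, d / 2 + 1 ≤ k → ∀ (r : Lp ℂ 2 (volume : Measure (Euc d))) (b : ℝ), 0 ≤ b →
        (∀ ξ ∈ Ξ, 𝓕 (r : Euc d → ℂ) ((2 * Real.pi)⁻¹ • ξ) = 0) →
        ∫⁻ x, ENNReal.ofReal ((‖x‖ ^ 2 + ε) ^ k) * ‖r x‖ₑ ^ 2 = ENNReal.ofReal (b ^ 2) →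
        ∀ (σ : ℝ), 0 < σ → ∀ (φ : Euc d → ℂ), tsupport φ ⊆ Metric.closedBall 0 σ →
        ∀ (h2 : MemLp φ 2) (hΦ : MemLp (fun x => (((‖x‖ ^ 2 + ε) ^ k : ℝ) : ℂ) * φ x) 2),
        b ^ 2 ≤ ‖r‖ * ‖hΦ.toLp _‖ →
        ‖r‖ ≤ (c * lam * (σ + ε)) ^ (2 * k) * ‖h2.toLp φ‖ := by
  obtain ⟨C, hC, H⟩ := exists_norm_le_of_fourier_eq_zero (d := d) hε
  refine ⟨C * (1 + ε⁻¹), by positivity,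
    fun lam Ξ hlam hcov k hk r b hb hr hrb σ hσ φ hφ h2 hΦ hbn => ?_⟩
  have h1 := le_pow_mul_of_sq_le (norm_nonneg r) (H lam Ξ hlam hcov k hk r b hb hr hrb) hbn
    (norm_nonneg _)
  have h3 : σ ^ 2 + ε ≤ ((1 + ε⁻¹) * (σ + ε)) ^ 2 := by
    have h4 : 1 + ε⁻¹ ≤ (1 + ε⁻¹) ^ 2 := le_self_pow₀ (by simp [hε.le]) two_ne_zero
    rw [mul_pow]
    exact (sq_add_le hε hσ).trans (by gcongr)
  calc ‖r‖ ≤ ((C * lam) ^ k) ^ 2 * ‖hΦ.toLp _‖ := h1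
    _ ≤ ((C * lam) ^ k) ^ 2 * ((((1 + ε⁻¹) * (σ + ε)) ^ 2) ^ k * ‖h2.toLp φ‖) := by
        gcongr
        exact (norm_toLp_weight_mul_le hε hφ h2 hΦ).trans (by gcongr)
    _ = _ := by
        rw [← pow_mul, ← pow_mul, mul_comm k 2, ← mul_assoc, ← mul_pow]
        ring_nf

end ErrorBound

/-! ### Convergence of the expansions -/

/-- `(2π) ^ (-1/2) (2π) ^ (d/2)` is the inverse of the factor `(2π) ^ ((1-d)/2)`. -/
theorem two_pi_rpow_mul (d : ℕ) :
    (((2 * Real.pi) ^ ((1 - (d : ℝ)) / 2) : ℝ) : ℂ) *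
      ((((2 * Real.pi) ^ (-(1 : ℝ) / 2) : ℝ) : ℂ) * (((2 * Real.pi) ^ ((d : ℝ) / 2) : ℝ) : ℂ)) =
      1 := by
  rw [← Complex.ofReal_mul, ← Complex.ofReal_mul, ← Real.rpow_add Real.two_pi_pos,
    ← Real.rpow_add Real.two_pi_pos]
  have : (1 - (d : ℝ)) / 2 + (-1 / 2 + (d : ℝ) / 2) = 0 := by ring
  rw [this, Real.rpow_zero, Complex.ofReal_one]

theorem lemma3p2 (d : ℕ) [NeZero d] (ε : ℝ) (hε : 0 < ε) :
    ∃ c : ℝ, 0 < c ∧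
      ∀ (lam : ℝ) (Ξ : Set (RadonSampling.Euc d)), 0 < lam →
        RadonSampling.IsKnotSet lam Ξ → RadonSampling.UniformlySeparated Ξ →
        -- the functions `Λ^k_ν` exist and are uniquely determined for every `k > d / 2`
        (∀ (k : ℕ) (ν : Ξ), d / 2 + 1 ≤ k →
          ∃! Λ : Lp ℂ 2 (volume : Measure (RadonSampling.Euc d)),
            RadonSampling.IsDualLagrange ε Ξ k ν Λ) ∧
        ∀ Λ : ℕ → Ξ → Lp ℂ 2 (volume : Measure (RadonSampling.Euc d)),
          (∀ (k : ℕ) (ν : Ξ), d / 2 + 1 ≤ k → RadonSampling.IsDualLagrange ε Ξ k ν (Λ k ν)) →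
          ∀ σ : ℝ, 0 < σ → lam < (c * (σ + ε))⁻¹ →
          ∀ r : ℕ, d / 2 + 1 ≤ r →
          ∀ φ : RadonSampling.Euc d → ℂ, ContDiff ℝ ∞ φ → tsupport φ ⊆ Metric.closedBall 0 σ →
            ∃ (hφ : MemLp φ 2 (volume : Measure (RadonSampling.Euc d)))
              (T : ℕ → Lp ℂ 2 (volume : Measure (RadonSampling.Euc d))),
              -- `T l` is the sum over all knots, unconditionally convergent in `L²`
              (∀ l : ℕ, HasSum
                (fun ν : Ξ => RadonSampling.radonFourierAt φ (ν : RadonSampling.Euc d) •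
                  Λ (2 ^ l * r) ν) (T l)) ∧
              Tendsto (fun l : ℕ =>
                (((2 * Real.pi) ^ ((1 - (d : ℝ)) / 2) : ℝ) : ℂ) • T l) atTop (𝓝 (hφ.toLp φ)) ∧
              ∀ l : ℕ,
                ‖hφ.toLp φ - (((2 * Real.pi) ^ ((1 - (d : ℝ)) / 2) : ℝ) : ℂ) • T l‖ ≤
                  2 * (c * lam * (σ + ε)) ^ (2 ^ (l + 1) * r) * RadonSampling.radonNorm φ := by
  obtain ⟨c, hc, H⟩ := exists_norm_remainder_le (d := d) hε
  refine ⟨c, hc, fun lam Ξ hlam hΞ hsep => ⟨fun k ν hk => ?_, ?_⟩⟩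
  · obtain ⟨Λ₀, hΛ₀, -⟩ := exists_dualLagrange_expansion (k := k) hε (by omega) hsep
    exact ⟨Λ₀ ν, (hΛ₀ ν _).2 rfl, fun Λ hΛ => (hΛ₀ ν Λ).1 hΛ⟩
  intro Λ hΛ σ hσ hlamσ r hr φ hφ hsupp
  have hcs : HasCompactSupport φ :=
    (isCompact_closedBall (0 : RadonSampling.Euc d) σ).of_isClosed_subset
      (isClosed_tsupport φ) hsupp
  have h2 : MemLp φ 2 (volume : Measure (RadonSampling.Euc d)) :=
    hφ.continuous.memLp_of_hasCompactSupport hcs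
  have hk : ∀ l : ℕ, d / 2 + 1 ≤ 2 ^ l * r := fun l =>
    hr.trans (Nat.le_mul_of_pos_left r (by positivity))
  have hstep : ∀ l : ℕ, ∃ T : Lp ℂ 2 (volume : Measure (RadonSampling.Euc d)),
      HasSum (fun ν : Ξ => RadonSampling.radonFourierAt φ (ν : RadonSampling.Euc d) •
        Λ (2 ^ l * r) ν) T ∧
      ‖h2.toLp φ - (((2 * Real.pi) ^ ((1 - (d : ℝ)) / 2) : ℝ) : ℂ) • T‖ ≤
        (c * lam * (σ + ε)) ^ (2 ^ (l + 1) * r) * ‖h2.toLp φ‖ := by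
    intro l
    have hl := hk l
    obtain ⟨Λ₀, hΛ₀, hexp⟩ :=
      exists_dualLagrange_expansion (k := 2 ^ l * r) hε (by omega) hsep
    have hΦ : MemLp (fun x => (((‖x‖ ^ 2 + ε) ^ (2 ^ l * r) : ℝ) : ℂ) * φ x) 2
        (volume : Measure (RadonSampling.Euc d)) :=
      memLp_ofReal_mul hφ.continuous hcs (by fun_prop)
    obtain ⟨ρ, b, hb, hsum, hzero, hρb, hbn⟩ := hexp φ hφ.continuous hcs h2 hΦ
    refine ⟨(((2 * Real.pi) ^ (-(1 : ℝ) / 2) : ℝ) : ℂ) •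
      (((2 * Real.pi) ^ ((d : ℝ) / 2) : ℝ) : ℂ) • (h2.toLp φ - ρ), ?_, ?_⟩
    · refine (hsum.const_smul _).congr_fun fun ν => ?_
      rw [radonFourierAt_eq_fourier hφ.continuous hcs, (hΛ₀ ν _).1 (hΛ _ ν hl), mul_smul]
    · rw [smul_smul, smul_smul, mul_assoc, two_pi_rpow_mul, one_smul, sub_sub_cancel]
      have := H lam Ξ hlam (hΞ.exists_dist_le hlam.le) _ hl ρ b hb hzero hρb σ hσ φ hsupp h2 hΦ hbn
      rwa [← mul_assoc, ← pow_succ'] at this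
  choose T hT hTb using hstep
  have h0 : 0 ≤ c * lam * (σ + ε) := by positivity
  have h1 : c * lam * (σ + ε) < 1 := by
    rw [lt_inv_comm₀ hlam (by positivity)] at hlamσ
    calc c * lam * (σ + ε) = c * (σ + ε) * lam := by ring
      _ < lam⁻¹ * lam := by gcongr
      _ = 1 := inv_mul_cancel₀ hlam.ne'
  refine ⟨h2, T, hT, ?_, fun l => (hTb l).trans ?_⟩
  · rw [tendsto_iff_norm_sub_tendsto_zero]
    have hexp : Tendsto (fun l : ℕ => 2 ^ (l + 1) * r) atTop atTop := by
      refine tendsto_atTop_mono (fun l => ?_) tendsto_id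
      have h3 : l < 2 ^ l := Nat.lt_two_pow_self
      have h4 : 2 ^ l ≤ 2 ^ (l + 1) := Nat.pow_le_pow_right two_pos (Nat.le_succ l)
      exact (h3.le.trans h4).trans (Nat.le_mul_of_pos_right _ (by omega))
    have hlim := ((tendsto_pow_atTop_nhds_zero_of_lt_one h0 h1).comp hexp).mul_const ‖h2.toLp φ‖
    rw [zero_mul] at hlim
    refine squeeze_zero (fun l => norm_nonneg _) (fun l => ?_) hlim
    rw [norm_sub_rev]
    exact hTb l
  · have hR := norm_toLp_le_radonNorm hφ.continuous hcs h2
    have hpow : 0 ≤ (c * lam * (σ + ε)) ^ (2 ^ (l + 1) * r) := pow_nonneg h0 _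
    -- The factor `2` of the statement is not needed.
    calc _ ≤ (c * lam * (σ + ε)) ^ (2 ^ (l + 1) * r) * RadonSampling.radonNorm φ := by gcongr
      _ ≤ 2 * ((c * lam * (σ + ε)) ^ (2 ^ (l + 1) * r) * RadonSampling.radonNorm φ) :=
          le_mul_of_one_le_left (mul_nonneg hpow ((norm_nonneg _).trans hR)) one_le_two
      _ = _ := by ring
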